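/- Let $g\ge 0$, $r\ge 1$, $\delta\ge 3$, $\beta\ge 1$, $r\le d\le r+\delta-2$ and $d_{\min}$ be integers, and put $\alpha=(d-r+1)\beta$ and $n=g(r+\delta-1)$. Consider $n$ storage nodes, divided into $g$ disjoint local groups of $r+\delta-1$ nodes, where each node stores $\alpha$ symbols over a finite field $\mathbb F$. An $(r,\delta,\alpha,\beta,d)$ MSR-LRC is a (not necessarily linear) code $\mathcal C\subseteq(\mathbb F^{\alpha})^n$ whose restriction to each local group is an MSR code: it has $|\mathbb F|^{r\alpha}$ codewords and minimum block distance $\delta$, and whenever a node of the group fails, its content is a function of $\beta$ symbols sent by each of $d$ arbitrary surviving nodes of the group, each such $\beta$ symbols being a function of the content of the sending node (and of the identity of the failed node and of the contacted nodes). If $|\mathcal C|=|\mathbb F|^{\mathcal M}$ and $\mathcal C$ has minimum block distance $d_{\min}$, then $\mathcal C$ is called $d_{\min}$-optimal if $d_{\min}=n-\lceil\frac{\mathcal M}{\alpha}\rceil+1-\bigl(\lceil\frac{\mathcal M}{r\alpha}\rceil-1\bigr)(\delta-1)$. It is called linear if the code and all its repair maps are linear over $\mathbb F$. A secure file ${\bf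 f}^s$ of $\mathcal M^s$ uniform symbols, together with independent uniform random symbols ${\bf r}\in\mathbb F^{R}$, is encoded one-to-one onto the codewords of an MSR-LRC (so $\mathcal M=\mathcal M^s+R$). This system stores the file size $\mathcal M^s$ securely against an $(\ell_1,\ell_2)$-eavesdropper if $I({\bf f}^s;{\bf e})=0$ for all sets $\mathcal E_1,\mathcal E_2$ of $\ell_1$ and $\ell_2$ nodes and any choice of the $d$ contacted nodes in the repair of each node in $\mathcal E_2$, where ${\bf e}$ consists of the contents of the nodes in $\mathcal E_1\cup\mathcal E_2$ and of all symbols downloaded in the repairs of the nodes in $\mathcal E_2$. For given $d_{\min}$, the secrecy capacity is the largest file size that is stored securely in this way, over all finite fields and all $d_{\min}$-optimal $(r,\delta,\alpha,\beta,d)$ MSR-LRCs of length $n$ and minimum distance $d_{\min}$. Let $\mu=\bigl\lfloor\frac{n-d_{\min}+1}{r+\delta-1}\bigr\rfloor$, $h=n-d_{\min}+1-(r+\delta-1)\mu$, and let $\ell_1,\ell_2\ge 0$ satisfy $\ell_2r+\ell_1\le\mu r+\min\{h,r\}$. (1) Every file size $\mathcal M^s$ that is stored securely against an $(\ell_1,\ell_2)$-eavesdropper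 by an $(r,\delta,\alpha,\beta,d)$ MSR-LRC of length $n$ and minimum distance $d_{\min}$ ($d_{\min}$-optimal or not) satisfies $$\mathcal M^s\le(\mu r+\min\{h,r\}-\ell_2-\ell_1)\alpha-\ell_2(r-1)\beta .$$ (2) If some finite field admits a linear $d_{\min}$-optimal $(r,\delta,\alpha,\beta,d)$ MSR-LRC of length $n$ and minimum distance $d_{\min}$, then the secrecy capacity against an $(\ell_1,\ell_2)$-eavesdropper is exactly $$(\mu r+\min\{h,r\}-\ell_2-\ell_1)\alpha-\ell_2(r-1)\beta .$$ (3) If $d=r+\delta-2$ and $\alpha=(\delta-1)^r$ (so $\beta=(\delta-1)^{r-1}$), then for every integer $k$ with $r\le k\le gr$ such a linear $d_{\min}$-optimal MSR-LRC exists for $d_{\min}=n-k+1-\bigl(\lceil\frac{k}{r}\rceil-1\bigr)(\delta-1)$; hence the formula in (2) then holds unconditionally. -/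

import Mathlib

/-! ## Entropy and mutual information of functions of a uniformly distributed outcome -/

section Information

/-- `P[X = s]` when `ω` is drawn uniformly from the finite set `Ω`. -/
noncomputable def uniformProb {Ω S : Type*} [Fintype Ω] (X : Ω → S) (s : S) : ℝ :=
  (Nat.card {ω : Ω // X ω = s} : ℝ) / (Fintype.card Ω : ℝ)

open Classical in
/-- The base-`q` entropy `H(X) = -∑ₛ P[X = s] log_q P[X = s]`, `ω` uniform on `Ω`. The sum runs over
the values that `X` takes. -/
noncomputable def qEntropy {Ω S : Type*} [Fintype Ω] (q : ℕ) (X : Ω → S) : ℝ :=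
  -∑ s ∈ Finset.univ.image X, uniformProb X s * Real.logb q (uniformProb X s)

/-- The mutual information `I(X ; Y) = H(X) + H(Y) - H(X, Y)`. -/
noncomputable def qMutualInfo {Ω S T : Type*} [Fintype Ω] (q : ℕ) (X : Ω → S) (Y : Ω → T) : ℝ :=
  qEntropy q X + qEntropy q Y - qEntropy q (fun ω => (X ω, Y ω))

end Information

/-! ## Vector codes, exact repair, MSR codes -/

section Codes

/-- The content of a node: `α` symbols over `F`. -/
abbrev Block (F : Type) (α : ℕ) : Type := Fin α → F

open Classical in
/-- The minimum (block) Hamming distance of the vector code `C` is `D`; in particular `C` has at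
least two codewords. -/
def HasMinDist {ι X : Type} [Fintype ι] (C : Set (ι → X)) (D : ℕ) : Prop :=
  IsLeast {k : ℕ | ∃ c ∈ C, ∃ c' ∈ C, c ≠ c' ∧ hammingDist c c' = k} D

/-- The symbols sent for repairs in a group of `N` nodes: `V j D i x` are the `β` symbols that node
`i` with content `x` sends when node `j` fails and the newcomer contacts the nodes in `D`. -/
abbrev RepairMaps (F : Type) (N α β : ℕ) : Type :=
  Fin N → Finset (Fin N) → Fin N → Block F α → Block F β

/-- Exact repair: whichever node `j` fails, and whichever `d` surviving nodes are contacted, the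
content of `j` is a function of the `d * β` downloaded symbols. -/
def IsExactRepair {F : Type} {N α β : ℕ} (C : Set (Fin N → Block F α)) (d : ℕ)
    (V : RepairMaps F N α β) : Prop :=
  ∀ (j : Fin N) (D : Finset (Fin N)), j ∉ D → D.card = d →
    ∃ ψ : ({i // i ∈ D} → Block F β) → Block F α,
      ∀ c ∈ C, c j = ψ (fun i => V j D i (c i))

/-- `C`, with the repair maps `V`, is an `(N, kα, N - k + 1, α, β, d)` minimum storage regenerating
(MSR) code: file size `k * α`, the minimum distance of an MDS array code, and exact repair with
`d` helpers that send `β = α / (d - k + 1)` symbols each. -/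
structure IsMSRCode {F : Type} [Fintype F] {N α β : ℕ} (k d : ℕ) (C : Set (Fin N → Block F α))
    (V : RepairMaps F N α β) : Prop where
  le_helpers : k ≤ d
  helpers_lt : d + 1 ≤ N
  card_eq : C.ncard = Fintype.card F ^ (k * α)
  minDist : HasMinDist C (N - k + 1)
  bandwidth : (d - k + 1) * β = α
  repair : IsExactRepair C d V

end Codes

/-! ## Locally repairable codes -/

section LRC

/-- `g` disjoint local groups of `η` nodes each; the first coordinate is the group. -/
abbrev Node (g η : ℕ) : Type := Fin g × Fin η

/-- The code punctured to the local group `i`. -/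
def localCode {F : Type} {g η α : ℕ} (C : Set (Node g η → Block F α)) (i : Fin g) :
    Set (Fin η → Block F α) :=
  (fun c p => c (i, p)) '' C

/-- An `(r, δ, α, β, d)` MSR-LRC of length `g * (r + δ - 1)` and minimum distance `dmin`: the
restriction to every local group is an MSR code with `r + δ - 1` nodes, file size `r * α` and
minimum distance `(r + δ - 1) - r + 1 = δ`. This gives `(r, δ)` locality to every node. -/
structure IsMSRLRC {F : Type} [Fintype F] {g α β : ℕ} (r δ d dmin : ℕ)
    (C : Set (Node g (r + δ - 1) → Block F α))
    (V : Fin g → RepairMaps F (r + δ - 1) α β) : Prop where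
  localMSR : ∀ i, IsMSRCode r d (localCode C i) (V i)
  minDist : HasMinDist C dmin

/-- A locally repairable code with `n` nodes and file size `M` is `dmin`-optimal:
`dmin = n - ⌈M / α⌉ + 1 - (⌈M / (rα)⌉ - 1)(δ - 1)`. -/
def IsDminOptimal (n M r δ α dmin : ℕ) : Prop :=
  (dmin : ℤ) = n - (M ⌈/⌉ α : ℕ) + 1 - ((M ⌈/⌉ (r * α) : ℕ) - 1) * ((δ : ℤ) - 1)

/-- Over some finite field there is a linear (with linear repair maps) `dmin`-optimal
`(r, δ, α, β, d)` MSR-LRC with `g` local groups and minimum distance `dmin`. -/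
def ExistsLinearMSRLRC (g r δ α β d dmin : ℕ) : Prop :=
  ∃ (F : Type) (_ : Field F) (_ : Fintype F)
    (C : Submodule F (Node g (r + δ - 1) → Block F α))
    (V : Fin g → Fin (r + δ - 1) → Finset (Fin (r + δ - 1)) → Fin (r + δ - 1) →
      (Block F α →ₗ[F] Block F β)),
    IsMSRLRC (F := F) (β := β) r δ d dmin (C : Set (Node g (r + δ - 1) → Block F α))
        (fun i j D p => V i j D p) ∧
      IsDminOptimal (g * (r + δ - 1)) (Module.finrank F C) r δ α dmin

end LRC

/-! ## Eavesdroppers and secure file sizes -/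

section Secrecy

/-- What an eavesdropper sees of the codeword `c`: the content of the nodes in `E₁`, and, for the
nodes `j` in `E₂`, the content of `j` and all symbols downloaded in the repair of `j` from the nodes
`D j` of its local group. -/
def observation {F : Type} {g η α β : ℕ} (V : Fin g → RepairMaps F η α β)
    (E₁ E₂ : Finset (Node g η)) (D : Node g η → Finset (Fin η)) (c : Node g η → Block F α) :
    ({j // j ∈ E₁} → Block F α) ×
      ((j : {j // j ∈ E₂}) → Block F α × ({p // p ∈ D j.1} → Block F β)) :=
  (fun j => c j.1,
    fun j => (c j.1, fun p => V j.1.1 j.1.2 (D j.1) p.1 (c (j.1.1, p.1))))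

/-- The encoder `enc`, fed with a uniformly distributed secure file of `Ms` symbols and with `R`
independent uniformly distributed random symbols, is secure against every
`(ℓ₁, ℓ₂)`-eavesdropper: `I(fˢ ; e) = 0`. -/
def IsSecure {F : Type} [Fintype F] {g η α β Ms R : ℕ} (d ℓ₁ ℓ₂ : ℕ)
    (enc : (Fin Ms → F) × (Fin R → F) → Node g η → Block F α)
    (V : Fin g → RepairMaps F η α β) : Prop :=
  ∀ (E₁ E₂ : Finset (Node g η)) (D : Node g η → Finset (Fin η)),
    E₁.card = ℓ₁ → E₂.card = ℓ₂ → (∀ j ∈ E₂, j.2 ∉ D j ∧ (D j).card = d) →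
      qMutualInfo (Fintype.card F) (fun f : (Fin Ms → F) × (Fin R → F) => f.1)
        (fun f => observation V E₁ E₂ D (enc f)) = 0

/-- The file sizes that a DSS with `g` local groups employing an `(r, δ, α, β, d)` MSR-LRC of
minimum distance `dmin`, over some finite field, stores securely against an `(ℓ₁, ℓ₂)`-eavesdropper.
The secure file and the random symbols make up the file of `Ms + R` symbols, which is
encoded one-to-one onto the code. -/
def secureFileSizes (g r δ α β d dmin ℓ₁ ℓ₂ : ℕ) : Set ℕ :=
  {Ms | ∃ (F : Type) (_ : Field F) (_ : Fintype F) (R : ℕ)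
    (enc : (Fin Ms → F) × (Fin R → F) → Node g (r + δ - 1) → Block F α)
    (V : Fin g → RepairMaps F (r + δ - 1) α β),
    Function.Injective enc ∧ IsMSRLRC r δ d dmin (Set.range enc) V ∧ IsSecure d ℓ₁ ℓ₂ enc V}

/-- The same, for `dmin`-optimal MSR-LRCs only. -/
def secureFileSizesOptimal (g r δ α β d dmin ℓ₁ ℓ₂ : ℕ) : Set ℕ :=
  {Ms | ∃ (F : Type) (_ : Field F) (_ : Fintype F) (R : ℕ)
    (enc : (Fin Ms → F) × (Fin R → F) → Node g (r + δ - 1) → Block F α)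
    (V : Fin g → RepairMaps F (r + δ - 1) α β),
    Function.Injective enc ∧ IsMSRLRC r δ d dmin (Set.range enc) V ∧
      IsDminOptimal (g * (r + δ - 1)) (Ms + R) r δ α dmin ∧ IsSecure d ℓ₁ ℓ₂ enc V}

end Secrecy

/-! ### Entropy of functions of a uniform outcome -/

section Entropy

variable {Ω S T : Type*} [Fintype Ω]

/-! Converse. Let `T` consist of r nodes from each of μ groups and min(h, r) nodes of one more
group. By the MDS property of the local codes, `T` fixes n - dmin + 1 nodes and hence the codeword.
Let the eavesdropper watch one repair in each of ℓ₂ groups and read ℓ₁ further nodes of `T`. Once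
its β sent symbols are known, a helper has at most q^(α-β) possible contents, even for nonlinear
repair maps (`IsMSRCode.card_fiber_le`). Counting r - 1 such helpers per watched group leaves at
most q^B codewords, B being the claimed bound. The file is independent of the observation, so it has
at most B symbols (`le_of_isSecure`, `secureFileSizes_le`).

Achievability. Of the given optimal code with file size M, only one local code and k = ⌈M/α⌉ are
kept. Over a large extension field, a generic subspace of dimension kα in the g-fold product of that
local code is an MSR-LRC with the same dmin (`exists_linear_isMSRLRC`). Coset coding inside it lets
the random symbols fill a generic subspace of dimension ℓ₁α + ℓ₂dβ; this is at least the rank of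
every observation, so the randomness can mask any change of the file (`exists_secure_encoder`).
Since dβ = α + (r - 1)β and k = μr + min(h, r), the remaining dimension equals the converse bound.

Existence. The same generic construction needs only one linear MSR code with d = r + δ - 2 and α =
(δ - 1)^r: a shortened coupled-layer code on an r × (δ - 1) grid, or a repetition code if r = 1
(`exists_isLinearMSR`). -/

lemma uniformProb_apply_pos (X : Ω → S) (ω : Ω) : 0 < uniformProb X (X ω) := by
  have : Nonempty {ω' // X ω' = X ω} := ⟨⟨ω, rfl⟩⟩
  have : Nonempty Ω := ⟨ω⟩
  unfold uniformProb
  have := Nat.card_pos (α := {ω' // X ω' = X ω})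
  have := Fintype.card_pos (α := Ω)
  positivity

/-- Entropy as an average over outcomes instead of a sum over values. -/
lemma qEntropy_eq_average (q : ℕ) (X : Ω → S) :
    qEntropy q X = -(∑ ω, Real.logb q (uniformProb X (X ω))) / Fintype.card Ω := by
  classical
  rw [Finset.sum_comp (fun s => Real.logb q (uniformProb X s)) X, neg_div, Finset.sum_div]
  unfold qEntropy
  congr 1
  refine Finset.sum_congr (by congr!) fun s _ => ?_
  rw [uniformProb, Nat.card_eq_fintype_card, Fintype.card_subtype, nsmul_eq_mul]
  ring

lemma qMutualInfo_eq_zero_of_indep (q : ℕ) (X : Ω → S) (Y : Ω → T)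
    (h : ∀ ω, uniformProb (fun ω => (X ω, Y ω)) (X ω, Y ω)
      = uniformProb X (X ω) * uniformProb Y (Y ω)) :
    qMutualInfo q X Y = 0 := by
  have hsum : ∑ ω, Real.logb q (uniformProb (fun ω => (X ω, Y ω)) (X ω, Y ω))
      = ∑ ω, Real.logb q (uniformProb X (X ω)) + ∑ ω, Real.logb q (uniformProb Y (Y ω)) := by
    rw [← Finset.sum_add_distrib]
    refine Finset.sum_congr rfl fun ω _ => ?_
    rw [h, Real.logb_mul (uniformProb_apply_pos X ω).ne' (uniformProb_apply_pos Y ω).ne']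
  rw [qMutualInfo, qEntropy_eq_average, qEntropy_eq_average, qEntropy_eq_average, hsum]
  ring

/-- Every attained pair has probability at least 1/|Ω|, while its `Y`-part has probability at most
K/|Ω|. Averaging the logarithms bounds the conditional entropy by log K. -/
lemma qEntropy_pair_sub_le [Nonempty Ω] {q K : ℕ} (hq : 1 < q) (X : Ω → S) (Y : Ω → T)
    (h : ∀ ω, Nat.card {ω' // Y ω' = Y ω} ≤ K) :
    qEntropy q (fun ω => (X ω, Y ω)) - qEntropy q Y ≤ Real.logb q K := by
  have hΩ : (0 : ℝ) < Fintype.card Ω := by exact_mod_cast Fintype.card_pos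
  have key : ∀ ω, Real.logb q (uniformProb Y (Y ω)) ≤
      Real.logb q (uniformProb (fun ω => (X ω, Y ω)) (X ω, Y ω)) + Real.logb q K := by
    intro ω
    have hp := uniformProb_apply_pos (fun ω => (X ω, Y ω)) ω
    have hn : Nonempty {ω' // Y ω' = Y ω} := ⟨⟨ω, rfl⟩⟩
    have hK : 0 < K := (Nat.card_pos (α := {ω' // Y ω' = Y ω})).trans_le (h ω)
    have hn' : Nonempty {ω' // (X ω', Y ω') = (X ω, Y ω)} := ⟨⟨ω, rfl⟩⟩
    have h1 : (1 : ℝ) ≤ Nat.card {ω' // (X ω', Y ω') = (X ω, Y ω)} := by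
      exact_mod_cast (Nat.card_pos (α := {ω' // (X ω', Y ω') = (X ω, Y ω)}))
    rw [← Real.logb_mul hp.ne' (by positivity)]
    refine Real.logb_le_logb_of_le (by exact_mod_cast hq) (uniformProb_apply_pos Y ω) ?_
    have h2 : (Nat.card {ω' // Y ω' = Y ω} : ℝ) ≤ K := by exact_mod_cast h ω
    unfold uniformProb
    rw [div_mul_eq_mul_div]
    gcongr
    nlinarith
  have hsum := Finset.sum_le_sum fun ω (_ : ω ∈ Finset.univ) => key ω
  rw [Finset.sum_add_distrib, Finset.sum_const, Finset.card_univ, nsmul_eq_mul] at hsum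
  rw [qEntropy_eq_average, qEntropy_eq_average, ← sub_div, div_le_iff₀ hΩ]
  linarith

lemma natCard_fst_fiber {A B : Type*} (a : A) :
    Nat.card {x : A × B // x.1 = a} = Nat.card B :=
  Nat.card_congr
    { toFun := fun x => x.1.2
      invFun := fun b => ⟨(a, b), rfl⟩
      left_inv := by rintro ⟨⟨a', b⟩, rfl⟩; rfl
      right_inv := fun _ => rfl }

lemma qEntropy_fst {F : Type*} [Fintype F] (hF : 1 < Fintype.card F) (m k : ℕ) :
    qEntropy (Fintype.card F) (fun f : (Fin m → F) × (Fin k → F) => f.1) = m := by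
  have hF' : (1 : ℝ) < Fintype.card F := by exact_mod_cast hF
  have hp : ∀ f : (Fin m → F) × (Fin k → F),
      uniformProb (fun f : (Fin m → F) × (Fin k → F) => f.1) f.1
        = ((Fintype.card F : ℝ) ^ m)⁻¹ := by
    intro f
    have : (Fintype.card F : ℝ) ^ k ≠ 0 := by positivity
    have : (Fintype.card F : ℝ) ^ m ≠ 0 := by positivity
    rw [uniformProb, natCard_fst_fiber]
    simp
    field_simp
  have : Nonempty F := Fintype.card_pos_iff.1 (by omega)
  rw [qEntropy_eq_average]
  simp_rw [hp]
  rw [Finset.sum_const, Finset.card_univ, nsmul_eq_mul, Real.logb_inv, Real.logb_pow,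
    Real.logb_self_eq_one hF']
  have : (Fintype.card ((Fin m → F) × (Fin k → F)) : ℝ) ≠ 0 := by
    exact_mod_cast Fintype.card_ne_zero
  field_simp

/-- A uniform file that is independent of `Y` has at most as many symbols as are left open
by the value of `Y`. -/
lemma le_of_qMutualInfo_fst_eq_zero {F : Type*} [Fintype F] (hF : 1 < Fintype.card F) {m k B : ℕ}
    (Y : (Fin m → F) × (Fin k → F) → T)
    (hI : qMutualInfo (Fintype.card F) (fun f : (Fin m → F) × (Fin k → F) => f.1) Y = 0)
    (h : ∀ f, Nat.card {f' // Y f' = Y f} ≤ Fintype.card F ^ B) : m ≤ B := by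
  have hF' : (1 : ℝ) < Fintype.card F := by exact_mod_cast hF
  have : Nonempty F := Fintype.card_pos_iff.1 (by omega)
  have h1 := qEntropy_pair_sub_le hF (fun f : (Fin m → F) × (Fin k → F) => f.1) Y h
  rw [qMutualInfo, qEntropy_fst hF] at hI
  push_cast at h1
  rw [Real.logb_pow, Real.logb_self_eq_one hF'] at h1
  have : (m : ℝ) ≤ B := by linarith
  exact_mod_cast this

end Entropy

/-! ### Counting in codes with exact repair -/

section CodeBounds

variable {F : Type} {N α β : ℕ}

open Classical in
lemma hammingDist_add_card_le {ι X : Type} [Fintype ι] {c c' : ι → X} (A : Finset ι)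
    (h : ∀ i ∈ A, c i = c' i) : hammingDist c c' + A.card ≤ Fintype.card ι := by
  unfold hammingDist
  rw [← Finset.card_union_of_disjoint]
  · exact Finset.card_le_univ _
  · rw [Finset.disjoint_left]
    intro i hi hA
    exact (Finset.mem_filter.1 hi).2 (h i hA)

lemma HasMinDist.eq_of_agree {ι X : Type} [Fintype ι] {C : Set (ι → X)} {D : ℕ}
    (hC : HasMinDist C D) {c c' : ι → X} (hc : c ∈ C) (hc' : c' ∈ C) (A : Finset ι)
    (hA : Fintype.card ι < D + A.card) (h : ∀ i ∈ A, c i = c' i) : c = c' := by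
  by_contra hne
  have h1 := hC.2 ⟨c, hc, c', hc', hne, rfl⟩
  have h2 := hammingDist_add_card_le A h
  omega

open Classical in
lemma HasMinDist.pos {ι X : Type} [Fintype ι] {C : Set (ι → X)} {D : ℕ}
    (hC : HasMinDist C D) : 0 < D := by
  obtain ⟨c, -, c', -, hne, hD⟩ := hC.1
  rw [← hD]
  exact hammingDist_pos.2 hne

open Classical in
lemma HasMinDist.le_card {ι X : Type} [Fintype ι] {C : Set (ι → X)} {D : ℕ}
    (hC : HasMinDist C D) : D ≤ Fintype.card ι := by
  obtain ⟨c, -, c', -, hne, hD⟩ := hC.1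
  rw [← hD]
  exact hammingDist_le_card_fintype

namespace IsMSRCode

variable [Fintype F] {r d : ℕ} {C : Set (Fin N → Block F α)} {V : RepairMaps F N α β}

lemma eq_of_agree (hC : IsMSRCode r d C V) {c c' : Fin N → Block F α} (hc : c ∈ C) (hc' : c' ∈ C)
    (A : Finset (Fin N)) (hA : r ≤ A.card) (h : ∀ i ∈ A, c i = c' i) : c = c' := by
  refine hC.minDist.eq_of_agree hc hc' A ?_ h
  have := hC.le_helpers
  have := hC.helpers_lt
  simp only [Fintype.card_fin]
  omega

/-- Restriction to r nodes is injective by the minimum distance, and both sides have q^(rα)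
elements. This is the MDS property without linearity. -/
lemma exists_extending (hC : IsMSRCode r d C V) (A : Finset (Fin N)) (hA : A.card = r)
    (x : Fin N → Block F α) : ∃ c ∈ C, ∀ i ∈ A, c i = x i := by
  classical
  have hfin : Finite C := inferInstance
  have := Fintype.ofFinite C
  let f : C → (A → Block F α) := fun c i => c.1 i
  have hf : Function.Injective f := by
    rintro ⟨c, hc⟩ ⟨c', hc'⟩ h
    exact Subtype.ext (hC.eq_of_agree hc hc' A hA.ge fun i hi => congrFun h ⟨i, hi⟩)
  have hcard : Fintype.card C = Fintype.card (A → Block F α) := by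
    rw [← Nat.card_eq_fintype_card, Nat.card_coe_set_eq, hC.card_eq]
    simp [hA, ← pow_mul, mul_comm]
  obtain ⟨⟨c, hc⟩, h⟩ := ((Fintype.bijective_iff_injective_and_card f).2 ⟨hf, hcard⟩).2
    (fun i => x i)
  exact ⟨c, hc, fun i hi => congrFun h ⟨i, hi⟩⟩

/-- The content of a helper node that is compatible with the symbols it sends
has at least `β` symbols less of freedom. -/
lemma card_fiber_le (hC : IsMSRCode r d C V) (hr : 1 ≤ r) {j : Fin N} {D : Finset (Fin N)}
    (hj : j ∉ D) (hD : D.card = d) {i : Fin N} (hi : i ∈ D) (v : Block F β) :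
    Nat.card {x // V j D i x = v} ≤ Fintype.card F ^ (α - β) := by
  classical
  have hrd := hC.le_helpers
  -- Freeze r - 1 helpers other than `i`. Each content `x` of `i` then extends to a codeword `c x`,
  -- and only the d - r helpers in `B` remain free.
  obtain ⟨A, hAD, hA⟩ := Finset.exists_subset_card_eq (s := D.erase i) (n := r - 1)
    (by rw [Finset.card_erase_of_mem hi]; omega)
  have hiA : i ∉ A := fun h => by simpa using hAD h
  have hjA : j ∉ A := fun h => hj (Finset.mem_of_mem_erase (hAD h))
  by_cases hne : Nonempty (Block F α)
  swap
  · have : IsEmpty {x // V j D i x = v} := ⟨fun x => hne ⟨x.1⟩⟩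
    simp
  obtain ⟨x₀⟩ := hne
  have hex : ∀ x : Block F α, ∃ c ∈ C, (∀ k ∈ A, c k = x₀) ∧ c i = x := by
    intro x
    obtain ⟨c, hc, h⟩ := hC.exists_extending (insert i A)
      (by rw [Finset.card_insert_of_notMem hiA]; omega) (fun k => if k = i then x else x₀)
    refine ⟨c, hc, fun k hk => ?_, by simpa using h i (by simp)⟩
    have hki : k ≠ i := fun e => hiA (e ▸ hk)
    simpa [hki] using h k (by simp [hk])
  choose c hcC hcA hci using hex
  let B : Finset (Fin N) := (D.erase i) \ A
  have hB : B.card = d - r := by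
    rw [Finset.card_sdiff_of_subset hAD, Finset.card_erase_of_mem hi]
    omega
  -- With `A` frozen and the symbols from `i` fixed, the downloads from `B` determine node `j`; then
  -- `j` and `A` are r nodes and determine the codeword, so `x`.
  let f : {x // V j D i x = v} → (B → Block F β) := fun x k => V j D k (c x.1 k)
  have hf : Function.Injective f := by
    rintro ⟨x, hx⟩ ⟨y, hy⟩ hxy
    obtain ⟨ψ, hψ⟩ := hC.repair j D hj hD
    have hjc : c x j = c y j := by
      rw [hψ _ (hcC x), hψ _ (hcC y)]
      congr 1
      funext ⟨k, hk⟩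
      dsimp only
      by_cases hki : k = i
      · subst hki; rw [hci, hci, hx, hy]
      by_cases hkA : k ∈ A
      · rw [hcA x k hkA, hcA y k hkA]
      · exact congrFun hxy ⟨k, by simp [B, hk, hki, hkA]⟩
    have hxy' : c x = c y := by
      refine hC.eq_of_agree (hcC x) (hcC y) (insert j A) ?_ ?_
      · rw [Finset.card_insert_of_notMem hjA]; omega
      · intro k hk
        rcases Finset.mem_insert.1 hk with rfl | hk
        · exact hjc
        · rw [hcA x k hk, hcA y k hk]
    refine Subtype.ext ?_
    change x = y
    rw [← hci x, ← hci y, hxy']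
  refine (Nat.card_le_card_of_injective f hf).trans (le_of_eq ?_)
  have hαβ : α - β = (d - r) * β := by
    rw [← hC.bandwidth, add_mul, one_mul, Nat.add_sub_cancel]
  rw [Nat.card_eq_fintype_card]
  simp [hB, hαβ, ← pow_mul, mul_comm]

end IsMSRCode

/-! ### Codewords compatible with an observation -/

section Counting

variable [Fintype F] {g η : ℕ}

open Classical in
/-- Counting the codewords that the eavesdropper cannot tell apart: if the nodes in `T` determine
the codeword, and the eavesdropper sees `E₁`, `E₂` and the symbols that the nodes in `H` send. -/
lemma le_of_isSecure {Ms R d ℓ₁ ℓ₂ : ℕ} (hF : 1 < Fintype.card F)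
    {enc : (Fin Ms → F) × (Fin R → F) → Node g η → Block F α}
    {V : Fin g → RepairMaps F η α β} (hinj : Function.Injective enc)
    (hsec : IsSecure d ℓ₁ ℓ₂ enc V) (T E₁ E₂ H : Finset (Node g η))
    (hE₁T : E₁ ⊆ T) (hE₂T : E₂ ⊆ T) (hHT : H ⊆ T)
    (h12 : Disjoint E₁ E₂) (h1H : Disjoint E₁ H) (h2H : Disjoint E₂ H)
    (hE₁ : E₁.card = ℓ₁) (hE₂ : E₂.card = ℓ₂)
    (D : Node g η → Finset (Fin η)) (hD : ∀ j ∈ E₂, j.2 ∉ D j ∧ (D j).card = d)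
    (hH : ∀ t ∈ H, ∃ p, (t.1, p) ∈ E₂ ∧ t.2 ∈ D (t.1, p))
    (hfib : ∀ j ∈ E₂, ∀ p ∈ D j, ∀ v,
      Nat.card {x // V j.1 j.2 (D j) p x = v} ≤ Fintype.card F ^ (α - β))
    (hβα : β ≤ α)
    (hT : ∀ f f', (∀ t ∈ T, enc f t = enc f' t) → enc f = enc f')
    {B : ℕ} (hB : B + ℓ₁ * α + ℓ₂ * α + H.card * β = T.card * α) : Ms ≤ B := by
  classical
  have hne : 0 < Fintype.card F := by omega
  refine le_of_qMutualInfo_fst_eq_zero hF _ (hsec E₁ E₂ D hE₁ hE₂ hD) fun f₀ => ?_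
  -- `p t` is a failed position whose repair reveals symbols of `t`; its value outside `H` is
  -- irrelevant.
  have hH' : ∀ t : Node g η, ∃ p, t ∈ H → (t.1, p) ∈ E₂ ∧ t.2 ∈ D (t.1, p) := by
    intro t
    by_cases ht : t ∈ H
    · obtain ⟨p, hp⟩ := hH t ht
      exact ⟨p, fun _ => hp⟩
    · exact ⟨t.2, fun h => absurd h ht⟩
  choose p hp using hH'
  have hpE := fun t ht => (hp t ht).1
  have hpD := fun t ht => (hp t ht).2
  -- `S t` contains every content of `t` compatible with the observation, and q^(`w t`) bounds its
  -- size.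
  let S : Node g η → Set (Block F α) := fun t =>
    if t ∈ E₁ ∨ t ∈ E₂ then {enc f₀ t} else
    if t ∈ H then {x | V t.1 (p t) (D (t.1, p t)) t.2 x
      = V t.1 (p t) (D (t.1, p t)) t.2 (enc f₀ t)} else Set.univ
  let w : Node g η → ℕ := fun t =>
    if t ∈ E₁ ∨ t ∈ E₂ then 0 else if t ∈ H then α - β else α
  have hS : ∀ t, Nat.card (S t) ≤ Fintype.card F ^ w t := by
    intro t
    by_cases h1 : t ∈ E₁ ∨ t ∈ E₂
    · simp [S, w, h1]
    by_cases h2 : t ∈ H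
    · simp only [S, w, h1, h2, if_false, if_true]
      exact hfib (t.1, p t) (hpE t h2) t.2 (hpD t h2) _
    · simp [S, w, h1, h2]
  have hmem : ∀ f, observation V E₁ E₂ D (enc f) = observation V E₁ E₂ D (enc f₀) →
      ∀ t, enc f t ∈ S t := by
    intro f hf t
    have hf1 := congrArg Prod.fst hf
    have hf2 := congrArg Prod.snd hf
    by_cases h1 : t ∈ E₁ ∨ t ∈ E₂
    · simp only [S, h1, if_true, Set.mem_singleton_iff]
      rcases h1 with h1 | h1
      · exact congrFun hf1 ⟨t, h1⟩
      · exact congrArg Prod.fst (congrFun hf2 ⟨t, h1⟩)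
    by_cases h2 : t ∈ H
    · simp only [S, h1, h2, if_false, if_true, Set.mem_ofPred_eq]
      have := congrArg Prod.snd (congrFun hf2 ⟨(t.1, p t), hpE t h2⟩)
      exact congrFun this ⟨t.2, hpD t h2⟩
    · simp [S, h1, h2]
  have hle : Nat.card {f // observation V E₁ E₂ D (enc f) = observation V E₁ E₂ D (enc f₀)}
      ≤ Nat.card ((t : T) → S t) := by
    refine Nat.card_le_card_of_injective (fun f t => ⟨enc f.1 t, hmem f.1 f.2 t⟩) ?_
    rintro ⟨f, hf⟩ ⟨f', hf'⟩ h
    refine Subtype.ext (hinj (hT _ _ fun t ht => ?_))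
    exact congrArg Subtype.val (congrFun h ⟨t, ht⟩)
  refine hle.trans ?_
  rw [Nat.card_pi]
  refine (Finset.prod_le_prod' fun (t : T) _ => hS t.1).trans ?_
  rw [Finset.prod_pow_eq_pow_sum]
  refine Nat.pow_le_pow_right hne ?_
  rw [Finset.sum_coe_sort T w]
  -- `E₁`, `E₂` and `H` are disjoint, so at each node at most one of the three terms makes up for
  -- what `w` lacks from α.
  have hw : ∑ t ∈ T, (w t + (if t ∈ E₁ then α else 0) + (if t ∈ E₂ then α else 0)
      + (if t ∈ H then β else 0)) = ∑ t ∈ T, α := by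
    refine Finset.sum_congr rfl fun t _ => ?_
    by_cases h1 : t ∈ E₁
    · simp [w, h1, Finset.disjoint_left.1 h12 h1, Finset.disjoint_left.1 h1H h1]
    by_cases h2 : t ∈ E₂
    · simp [w, h1, h2, Finset.disjoint_left.1 h2H h2]
    by_cases h3 : t ∈ H
    · simp [w, h1, h2, h3, hβα]
    · simp [w, h1, h2, h3]
  simp only [Finset.sum_add_distrib, Finset.sum_ite_mem, Finset.inter_eq_right.2 hE₁T,
    Finset.inter_eq_right.2 hE₂T, Finset.inter_eq_right.2 hHT, Finset.sum_const, smul_eq_mul,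
    hE₁, hE₂] at hw
  omega

lemma card_filter_val_lt_of_le {m n : ℕ} (h : m ≤ n) :
    (Finset.univ.filter fun i : Fin n => i.1 < m).card = m := by
  rw [Fin.card_filter_val_lt]
  omega

end Counting

end CodeBounds

/-! ### Upper bound on secure file sizes -/

section UpperBound

open Classical in
lemma secureFileSizes_le {g r δ α β d dmin μ h ℓ₁ ℓ₂ Ms : ℕ} (hr : 1 ≤ r) (hδ : 2 < δ)
    (hμ : μ = (g * (r + δ - 1) - dmin + 1) / (r + δ - 1))
    (hh : h = (g * (r + δ - 1) - dmin + 1) - (r + δ - 1) * μ)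
    (hℓ : ℓ₂ * r + ℓ₁ ≤ μ * r + min h r)
    (hMs : Ms ∈ secureFileSizes g r δ α β d dmin ℓ₁ ℓ₂) :
    (Ms : ℤ) ≤ ((μ : ℤ) * r + min h r - ℓ₂ - ℓ₁) * α - ℓ₂ * ((r : ℤ) - 1) * β := by
  obtain ⟨F, _, _, R, enc, V, hinj, ⟨hloc, hdist⟩, hsec⟩ := hMs
  have hF : 1 < Fintype.card F := Fintype.one_lt_card
  have hcardn : Fintype.card (Node g (r + δ - 1)) = g * (r + δ - 1) := by simp
  have hd0 := hdist.pos
  have hdn := hdist.le_card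
  rw [hcardn] at hdn
  have hη : 0 < r + δ - 1 := by omega
  have hdm := Nat.div_add_mod (g * (r + δ - 1) - dmin + 1) (r + δ - 1)
  have hml := Nat.mod_lt (g * (r + δ - 1) - dmin + 1) hη
  rw [← hμ] at hdm
  have hhη : h < r + δ - 1 := by omega
  have hm : (r + δ - 1) * μ + h = g * (r + δ - 1) - dmin + 1 := by omega
  have hrη : r ≤ r + δ - 1 := by omega
  have hμg : μ ≤ g := by
    have : (r + δ - 1) * μ ≤ (r + δ - 1) * g := by
      rw [mul_comm _ g]
      omega
    exact Nat.le_of_mul_le_mul_left this hη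
  -- Since dmin ≥ 1, the n - dmin + 1 nodes fit into the g groups: a nonempty partial group has an
  -- index below g.
  have hcase : μ < g ∨ (μ = g ∧ h = 0) := by
    rcases hμg.lt_or_eq with h1 | h1
    · exact Or.inl h1
    · refine Or.inr ⟨h1, ?_⟩
      rw [h1, mul_comm] at hm
      omega
  -- ℓ₂ exceeds μ only if the partial group contributes r nodes, so every watched group has r nodes
  -- in `T`.
  have hℓμ : ℓ₂ ≤ μ ∨ (ℓ₂ = μ + 1 ∧ r ≤ h) := by
    by_contra! hcon
    obtain ⟨h1, h2⟩ := hcon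
    rcases Nat.lt_or_ge (μ + 1) ℓ₂ with h3 | h3
    · have : (μ + 2) * r ≤ ℓ₂ * r := Nat.mul_le_mul_right r h3
      have h4 := min_le_right h r
      rw [add_mul] at this
      omega
    · have h3 : ℓ₂ = μ + 1 := by omega
      have h4 := h2 h3
      rw [h3, add_mul, min_eq_left h4.le] at hℓ
      omega
  have hℓg : ℓ₂ ≤ g := by omega
  let T₁ : Finset (Node g (r + δ - 1)) :=
    (Finset.univ.filter fun i : Fin g => i.1 < μ) ×ˢ (Finset.univ.filter fun p => p.1 < r)
  let T₂ : Finset (Node g (r + δ - 1)) :=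
    (Finset.univ.filter fun i : Fin g => i.1 = μ) ×ˢ (Finset.univ.filter fun p => p.1 < min h r)
  let T := T₁ ∪ T₂
  have hTmem : ∀ t : Node g (r + δ - 1),
      t ∈ T ↔ (t.1.1 < μ ∧ t.2.1 < r) ∨ (t.1.1 = μ ∧ t.2.1 < min h r) := by
    intro t
    simp [T, T₁, T₂]
  have hTcard : T.card = μ * r + min h r := by
    rw [Finset.card_union_of_disjoint]
    · rw [Finset.card_product, Finset.card_product, card_filter_val_lt_of_le hμg,
        card_filter_val_lt_of_le hrη, card_filter_val_lt_of_le ((min_le_right h r).trans hrη)]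
      rcases hcase with h1 | ⟨h1, h2⟩
      · have : (Finset.univ.filter fun i : Fin g => i.1 = μ) = {⟨μ, h1⟩} := by
          ext i; simp [Fin.ext_iff]
        rw [this]; simp
      · simp [h2]
    · rw [Finset.disjoint_left]
      rintro t h1 h2
      simp only [T₁, T₂, Finset.mem_product, Finset.mem_filter, Finset.mem_univ, true_and] at h1 h2
      omega
  let E₂ : Finset (Node g (r + δ - 1)) :=
    (Finset.univ.filter fun i : Fin g => i.1 < ℓ₂) ×ˢ {⟨0, hη⟩}
  let H : Finset (Node g (r + δ - 1)) :=
    (Finset.univ.filter fun i : Fin g => i.1 < ℓ₂) ×ˢ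
      ((Finset.univ.filter fun p : Fin (r + δ - 1) => p.1 < r).erase ⟨0, hη⟩)
  have hE₂mem : ∀ t : Node g (r + δ - 1), t ∈ E₂ ↔ t.1.1 < ℓ₂ ∧ t.2.1 = 0 := by
    intro t; simp only [E₂, Finset.mem_product, Finset.mem_filter, Finset.mem_univ, true_and,
      Finset.mem_singleton, Fin.ext_iff]
  have hHmem : ∀ t : Node g (r + δ - 1), t ∈ H ↔ t.1.1 < ℓ₂ ∧ t.2.1 ≠ 0 ∧ t.2.1 < r := by
    intro t; simp [H, Fin.ext_iff]
  have hE₂card : E₂.card = ℓ₂ := by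
    rw [Finset.card_product, card_filter_val_lt_of_le hℓg]; simp
  have hHcard : H.card = ℓ₂ * (r - 1) := by
    rw [Finset.card_product, card_filter_val_lt_of_le hℓg, Finset.card_erase_of_mem,
      card_filter_val_lt_of_le hrη]
    simpa using by omega
  have hE₂T : E₂ ⊆ T := by
    intro t ht
    rw [hTmem]; rw [hE₂mem] at ht
    have : r ≤ h → min h r = r := min_eq_right
    omega
  have hHT : H ⊆ T := by
    intro t ht
    rw [hTmem]; rw [hHmem] at ht
    have : r ≤ h → min h r = r := min_eq_right
    omega
  have h2H : Disjoint E₂ H := by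
    rw [Finset.disjoint_left]
    intro t h1 h2
    rw [hE₂mem] at h1; rw [hHmem] at h2
    exact h2.2.1 h1.2
  have hℓr : ℓ₂ + ℓ₂ * (r - 1) = ℓ₂ * r := by
    obtain ⟨r, rfl⟩ : ∃ r', r = r' + 1 := ⟨r - 1, by omega⟩
    simp; ring
  obtain ⟨E₁, hE₁, hE₁card⟩ := Finset.exists_subset_card_eq (s := T \ (E₂ ∪ H)) (n := ℓ₁) (by
    rw [Finset.card_sdiff_of_subset (Finset.union_subset hE₂T hHT),
      Finset.card_union_of_disjoint h2H, hTcard, hE₂card, hHcard]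
    omega)
  have hE₁' : ∀ t ∈ E₁, t ∈ T ∧ t ∉ E₂ ∧ t ∉ H := by
    intro t ht
    have := hE₁ ht
    simpa using this
  by_cases hβα' : β ≤ α
  swap
  · -- no group, hence no codeword
    exfalso
    have hg : g = 0 := by
      by_contra hg
      have := (hloc ⟨0, by omega⟩).bandwidth
      rw [add_mul, one_mul] at this
      omega
    subst hg
    omega
  -- Positions 1, …, d. As r ≤ d, they include the r - 1 helpers in `H`.
  let D : Node g (r + δ - 1) → Finset (Fin (r + δ - 1)) :=
    fun _ => (Finset.univ.filter fun p => p.1 < d + 1).erase ⟨0, hη⟩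
  have hDmem : ∀ (t : Node g (r + δ - 1)) p, p ∈ D t ↔ p.1 ≠ 0 ∧ p.1 < d + 1 := by
    intro t p; simp [D, Fin.ext_iff]
  have hDcard : ∀ i : Fin g, ∀ t, (D t).card = d := by
    intro i t
    rw [Finset.card_erase_of_mem (by simp), card_filter_val_lt_of_le (hloc i).helpers_lt]
    rfl
  have hDE : ∀ j ∈ E₂, j.2 ∉ D j ∧ (D j).card = d := by
    intro j hj
    rw [hE₂mem] at hj
    refine ⟨?_, hDcard j.1 j⟩
    rw [hDmem j]; simp [hj.2]
  have hgroup : ∀ f f' (i : Fin g) (m : ℕ), m ≤ r + δ - 1 →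
      (∀ p : Fin (r + δ - 1), p.1 < min m r → enc f (i, p) = enc f' (i, p)) →
      ∀ p : Fin (r + δ - 1), p.1 < m → enc f (i, p) = enc f' (i, p) := by
    intro f f' i m hm' hagree p hp
    rcases le_total m r with h1 | h1
    · exact hagree p (by rwa [min_eq_left h1])
    · rw [min_eq_right h1] at hagree
      refine congrFun ((hloc i).eq_of_agree (c := fun p => enc f (i, p))
        (c' := fun p => enc f' (i, p)) ⟨_, ⟨f, rfl⟩, rfl⟩ ⟨_, ⟨f', rfl⟩, rfl⟩
        (Finset.univ.filter fun p => p.1 < r) (card_filter_val_lt_of_le hrη).ge ?_) p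
      intro p hp
      exact hagree p (by simpa using hp)
  have hT : ∀ f f', (∀ t ∈ T, enc f t = enc f' t) → enc f = enc f' := by
    intro f f' hff
    -- The n - dmin + 1 nodes fixed by `T`, one more than two distinct codewords can share.
    let S : Finset (Node g (r + δ - 1)) :=
      (Finset.univ.filter fun i : Fin g => i.1 < μ) ×ˢ Finset.univ ∪
      (Finset.univ.filter fun i : Fin g => i.1 = μ) ×ˢ (Finset.univ.filter fun p => p.1 < h)
    have hScard : S.card = (r + δ - 1) * μ + h := by
      rw [Finset.card_union_of_disjoint]
      · rw [Finset.card_product, Finset.card_product, card_filter_val_lt_of_le hμg,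
          card_filter_val_lt_of_le hhη.le]
        rcases hcase with h1 | ⟨h1, h2⟩
        · have : (Finset.univ.filter fun i : Fin g => i.1 = μ) = {⟨μ, h1⟩} := by
            ext i; simp [Fin.ext_iff]
          rw [this]; simp [mul_comm]
        · simp [h2, mul_comm]
      · rw [Finset.disjoint_left]
        rintro t h1 h2
        simp only [Finset.mem_product, Finset.mem_filter, Finset.mem_univ, true_and] at h1 h2
        omega
    refine hdist.eq_of_agree ⟨f, rfl⟩ ⟨f', rfl⟩ S (by rw [hScard, hcardn]; omega) ?_
    rintro ⟨i, p⟩ ht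
    simp only [S, Finset.mem_union, Finset.mem_product, Finset.mem_filter, Finset.mem_univ,
      true_and, and_true] at ht
    rcases ht with ht | ⟨ht, hp⟩
    · refine hgroup f f' i (r + δ - 1) le_rfl (fun p hp => hff (i, p) ?_) p p.2
      rw [hTmem]
      exact Or.inl ⟨ht, hp.trans_le (min_le_right _ _)⟩
    · refine hgroup f f' i h hhη.le (fun p hp => hff (i, p) ?_) p hp
      rw [hTmem]
      exact Or.inr ⟨ht, hp⟩
  obtain ⟨B, hB⟩ : ∃ B, B + ℓ₁ * α + ℓ₂ * α + H.card * β = T.card * α := by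
    refine ⟨T.card * α - (ℓ₁ * α + ℓ₂ * α + H.card * β), ?_⟩
    have h1 : H.card * β ≤ H.card * α := Nat.mul_le_mul_left _ hβα'
    have h2 : (ℓ₁ + ℓ₂ + H.card) * α ≤ T.card * α := by
      refine Nat.mul_le_mul_right _ ?_
      rw [hTcard, hHcard]; omega
    rw [add_mul, add_mul] at h2
    omega
  have hfin : Ms ≤ B := by
    refine le_of_isSecure hF hinj hsec T E₁ E₂ H (fun t ht => (hE₁' t ht).1) hE₂T hHT ?_ ?_ h2H
      hE₁card hE₂card D hDE ?_ ?_ hβα' hT hB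
    · exact Finset.disjoint_left.2 fun t ht => (hE₁' t ht).2.1
    · exact Finset.disjoint_left.2 fun t ht => (hE₁' t ht).2.2
    · intro t ht
      refine ⟨⟨0, hη⟩, ?_, ?_⟩
      · rw [hE₂mem]; rw [hHmem] at ht
        exact ⟨ht.1, rfl⟩
      · rw [hDmem t]; rw [hHmem] at ht
        have := (hloc t.1).le_helpers
        omega
    · intro j hj p hp v
      exact (hloc j.1).card_fiber_le hr (hDE j hj).1 (hDE j hj).2 hp v
  rw [hHcard, hTcard] at hB
  have hB' : (B : ℤ) + ℓ₁ * α + ℓ₂ * α + ℓ₂ * ((r : ℤ) - 1) * β = (μ * r + min h r) * α := by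
    have := congrArg (Nat.cast : ℕ → ℤ) hB
    push_cast [Nat.cast_sub hr] at this ⊢
    exact this
  have : (Ms : ℤ) ≤ B := by exact_mod_cast hfin
  push_cast at hB' ⊢
  linarith

end UpperBound

/-! ### Linear MSR codes -/

section LinearMSR

open Module

/-- A linear `(N, rα, N - r + 1, α, β, d)` MSR code, in terms of kernels. -/
structure IsLinearMSR {F : Type} [Field F] {N α β : ℕ} (r d : ℕ)
    (C : Submodule F (Fin N → Block F α))
    (V : Fin N → Finset (Fin N) → Fin N → (Block F α →ₗ[F] Block F β)) : Prop where
  finrank_eq : finrank F C = r * α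
  eq_zero : ∀ c ∈ C, ∀ A : Finset (Fin N), A.card = r → (∀ i ∈ A, c i = 0) → c = 0
  repair : ∀ (j : Fin N) (D : Finset (Fin N)), j ∉ D → D.card = d →
    ∀ c ∈ C, (∀ i ∈ D, V j D i (c i) = 0) → c j = 0

-- Differences of codewords are codewords, so only the zero sets of nonzero codewords matter.
open Classical in
lemma hasMinDist_of_linear {F ι X : Type} [Field F] [Fintype ι] [AddCommGroup X] [Module F X]
    {D : ℕ} (C : Submodule F (ι → X))
    (hlow : ∀ c ∈ C, ∀ A : Finset ι, A.card + D = Fintype.card ι + 1 → (∀ i ∈ A, c i = 0) → c = 0)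
    (hup : ∃ c ∈ C, c ≠ 0 ∧ ∃ A : Finset ι, A.card + D = Fintype.card ι ∧ ∀ i ∈ A, c i = 0) :
    HasMinDist (C : Set (ι → X)) D := by
  have hge : ∀ c ∈ C, c ≠ 0 → D ≤ hammingDist c 0 := by
    intro c hc hne
    by_contra! hlt
    let Z : Finset ι := Finset.univ.filter fun i => c i = 0
    have hZ : hammingDist c 0 + Z.card = Fintype.card ι := by
      have := Finset.card_filter_add_card_filter_not (s := (Finset.univ : Finset ι))
        (fun i => c i = 0)
      rw [Finset.card_univ] at this
      rw [← this, add_comm]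
      rfl
    by_cases hD : D ≤ Fintype.card ι + 1
    · obtain ⟨A, hAZ, hA⟩ := Finset.exists_subset_card_eq (s := Z)
        (n := Fintype.card ι + 1 - D) (by omega)
      exact hne (hlow c hc A (by omega) fun i hi => by simpa [Z] using hAZ hi)
    · obtain ⟨_, _, _, A, hA, _⟩ := hup
      omega
  constructor
  · obtain ⟨c, hc, hne, A, hA, hcA⟩ := hup
    refine ⟨c, hc, 0, C.zero_mem, hne, le_antisymm ?_ (hge c hc hne)⟩
    have := hammingDist_add_card_le (c := c) (c' := 0) A (fun i hi => hcA i hi)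
    omega
  · rintro _ ⟨c, hc, c', hc', hne, rfl⟩
    have := hge (c - c') (C.sub_mem hc hc') (sub_ne_zero.2 hne)
    have h2 : hammingDist (c - c') 0 = hammingDist c c' := by
      simp only [hammingDist, Pi.sub_apply, Pi.zero_apply, ne_eq, sub_eq_zero]
    exact this.trans_eq h2

/-- The restriction of the codewords to the positions in `A`. -/
def restrictTo {F ι : Type} [Field F] {α : ℕ} (C : Submodule F (ι → Block F α)) (A : Finset ι) :
    C →ₗ[F] (A → Block F α) :=
  (LinearMap.funLeft F (Block F α) (Subtype.val : A → ι)).comp C.subtype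

lemma finrank_pi_block (F ι : Type) [Field F] (α : ℕ) (A : Finset ι) :
    finrank F (A → Block F α) = A.card * α := by
  rw [finrank_pi_fintype]
  simp

lemma exists_ne_zero_vanishing {F ι : Type} [Field F] [Finite ι] {α : ℕ}
    (C : Submodule F (ι → Block F α)) (A : Finset ι) (hA : A.card * α < finrank F C) :
    ∃ c ∈ C, c ≠ 0 ∧ ∀ i ∈ A, c i = 0 := by
  have := LinearMap.ker_ne_bot_of_finrank_lt (f := restrictTo C A)
    (by rw [finrank_pi_block]; exact hA)
  obtain ⟨c, hc, hne⟩ := Submodule.exists_mem_ne_zero_of_ne_bot this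
  refine ⟨c, c.2, fun h => hne (Subtype.ext h), fun i hi => ?_⟩
  exact congrFun (LinearMap.mem_ker.1 hc) ⟨i, hi⟩

namespace IsLinearMSR

variable {F : Type} [Field F] {N α β r d : ℕ} {C : Submodule F (Fin N → Block F α)}
  {V : Fin N → Finset (Fin N) → Fin N → (Block F α →ₗ[F] Block F β)}

lemma exists_extending (hC : IsLinearMSR r d C V) (hN : r ≤ N) (A : Finset (Fin N))
    (hA : A.card ≤ r) (x : Fin N → Block F α) : ∃ c ∈ C, ∀ i ∈ A, c i = x i := by
  obtain ⟨A', hAA', hA'⟩ := Finset.exists_superset_card_eq (s := A) (n := r) hA (by simpa)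
  have hinj : Function.Injective (restrictTo C A') := by
    rw [← LinearMap.ker_eq_bot, LinearMap.ker_eq_bot']
    intro c hc
    exact Subtype.ext (hC.eq_zero c c.2 A' hA' fun i hi => congrFun hc ⟨i, hi⟩)
  have hsurj := (LinearMap.injective_iff_surjective_of_finrank_eq_finrank
    (by rw [hC.finrank_eq, finrank_pi_block, hA'])).1 hinj
  obtain ⟨c, hc⟩ := hsurj fun i => x i
  exact ⟨c, c.2, fun i hi => congrFun hc ⟨i, hAA' hi⟩⟩

lemma isMSRCode [Fintype F] (hC : IsLinearMSR r d C V) (hr : 1 ≤ r) (hα : 1 ≤ α) (hrd : r ≤ d)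
    (hdN : d + 1 ≤ N) (hbw : (d - r + 1) * β = α) :
    IsMSRCode r d (C : Set (Fin N → Block F α)) (fun j D i => V j D i) where
  le_helpers := hrd
  helpers_lt := hdN
  card_eq := by
    rw [← Nat.card_coe_set_eq, ← hC.finrank_eq, ← Nat.card_eq_fintype_card]
    exact natCard_eq_pow_finrank (K := F) (V := C)
  minDist := by
    refine hasMinDist_of_linear C (fun c hc A hA h => ?_) ?_
    · rw [Fintype.card_fin] at hA
      exact hC.eq_zero c hc A (by omega) h
    · obtain ⟨A, -, hA⟩ := Finset.exists_subset_card_eq (s := (Finset.univ : Finset (Fin N)))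
        (n := r - 1) (by simp; omega)
      obtain ⟨c, hc, hne, h⟩ := exists_ne_zero_vanishing C A (by
        rw [hA, hC.finrank_eq]
        exact Nat.mul_lt_mul_of_pos_right (by omega) hα)
      exact ⟨c, hc, hne, A, by rw [hA, Fintype.card_fin]; omega, h⟩
  bandwidth := hbw
  repair := by
    classical
    intro j D hj hD
    -- Any codeword with the same downloads has the right content at `j`, by the kernel condition;
    -- the value 0 is used only for downloads that no codeword produces.
    refine ⟨fun y => if h : ∃ c ∈ C, (fun i : {i // i ∈ D} => V j D i (c i)) = y then h.choose j
      else 0, fun c hc => ?_⟩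
    have hex : ∃ c' ∈ C, (fun i : {i // i ∈ D} => V j D i (c' i)) =
        fun i : {i // i ∈ D} => V j D i (c i) :=
      ⟨c, hc, rfl⟩
    beta_reduce
    rw [dif_pos hex]
    have hs := hex.choose_spec
    have := hC.repair j D hj hD (c - hex.choose) (C.sub_mem hc hs.1) fun i hi => by
      rw [Pi.sub_apply, map_sub, sub_eq_zero]
      exact (congrFun hs.2 ⟨i, hi⟩).symm
    exact sub_eq_zero.1 this

end IsLinearMSR

lemma IsMSRCode.isLinearMSR {F : Type} [Field F] [Fintype F] {N α β r d : ℕ}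
    {C : Submodule F (Fin N → Block F α)}
    {V : Fin N → Finset (Fin N) → Fin N → (Block F α →ₗ[F] Block F β)}
    (hC : IsMSRCode r d (C : Set (Fin N → Block F α)) (fun j D i => V j D i)) :
    IsLinearMSR r d C V where
  finrank_eq := by
    have h1 := hC.card_eq
    have := natCard_eq_pow_finrank (K := F) (V := C)
    rw [← Nat.card_coe_set_eq, ← Nat.card_eq_fintype_card] at h1
    exact Nat.pow_right_injective Finite.one_lt_card (this.symm.trans h1)
  eq_zero := fun c hc A hA h => hC.eq_of_agree hc C.zero_mem A hA.ge h
  repair := by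
    intro j D hj hD c hc h
    obtain ⟨ψ, hψ⟩ := hC.repair j D hj hD
    have h0 := hψ 0 C.zero_mem
    rw [hψ c hc]
    rw [Pi.zero_apply] at h0
    rw [h0]
    congr 1
    funext i
    simp [h i i.2]

end LinearMSR

/-! ### Extension of scalars -/

section ScalarExtension

open Module

variable {F : Type} (K : Type) [Field F] [Field K] [Algebra F K]

/-- The code over the extension field `K` with the same generator matrix, described by the fact
that every `F`-linear functional of `K` maps its codewords to codewords of `C`. -/
def extendCode {ι : Type} {α : ℕ} (C : Submodule F (ι → Block F α)) :
    Submodule K (ι → Block K α) where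
  carrier := {c | ∀ φ : K →ₗ[F] F, (fun i a => φ (c i a)) ∈ C}
  add_mem' := by
    intro c c' hc hc' φ
    convert C.add_mem (hc φ) (hc' φ) using 1
    ext i a
    simp
  zero_mem' := by
    intro φ
    convert C.zero_mem using 1
    ext i a
    simp
  smul_mem' := by
    intro k c hc φ
    exact hc (φ.comp (LinearMap.mulLeft F k))

/-- The linear map over `K` with the same matrix. -/
noncomputable def extendMap {α β : ℕ} (f : Block F α →ₗ[F] Block F β) :
    Block K α →ₗ[K] Block K β :=
  Matrix.toLin' ((LinearMap.toMatrix' f).map (algebraMap F K))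

variable {K}

/-- The matrix has entries in `F`, so an `F`-linear functional passes through it. -/
lemma functional_extendMap {α β : ℕ} (f : Block F α →ₗ[F] Block F β) (φ : K →ₗ[F] F)
    (x : Block K α) : (fun b => φ (extendMap K f x b)) = f (fun a => φ (x a)) := by
  conv_rhs => rw [← Matrix.toLin'_toMatrix' f]
  funext b
  simp only [extendMap, Matrix.toLin'_apply, Matrix.mulVec, dotProduct, Matrix.map_apply, map_sum]
  refine Finset.sum_congr rfl fun a _ => ?_
  rw [← Algebra.smul_def, map_smul, smul_eq_mul]

lemma eq_zero_of_functionals [FiniteDimensional F K] {x : K} (h : ∀ φ : K →ₗ[F] F, φ x = 0) :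
    x = 0 :=
  (Module.forall_dual_apply_eq_zero_iff F x).1 h

lemma mem_extendCode_iff [FiniteDimensional F K] {ι : Type} {α : ℕ}
    (C : Submodule F (ι → Block F α)) (c : ι → Block K α) :
    c ∈ extendCode K C ↔ ∀ m, (fun i a => (finBasis F K).repr (c i a) m) ∈ C := by
  constructor
  · intro h m
    exact h ((finBasis F K).coord m)
  · intro h φ
    have : (fun i a => φ (c i a))
        = ∑ m, φ (finBasis F K m) • fun i a => (finBasis F K).repr (c i a) m := by
      funext i a
      conv_lhs => rw [← (finBasis F K).sum_repr (c i a)]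
      rw [map_sum]
      simp [mul_comm]
    rw [this]
    exact C.sum_mem fun m _ => C.smul_mem _ (h m)

/-- Coordinates in an `F`-basis of `K` split a codeword into [K : F] independent words of `C`. -/
lemma natCard_extendCode [FiniteDimensional F K] {ι : Type} {α : ℕ}
    (C : Submodule F (ι → Block F α)) :
    Nat.card (extendCode K C) = Nat.card C ^ finrank F K := by
  let e : extendCode K C ≃ (Fin (finrank F K) → C) :=
    { toFun := fun c m => ⟨_, (mem_extendCode_iff C c.1).1 c.2 m⟩
      invFun := fun y => ⟨fun i a => (finBasis F K).equivFun.symm fun m => (y m).1 i a, by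
        rw [mem_extendCode_iff]
        intro m
        convert (y m).2 using 1
        ext i a
        rw [← Basis.equivFun_apply, LinearEquiv.apply_symm_apply]⟩
      left_inv := by
        intro c
        ext i a
        exact (finBasis F K).equivFun.symm_apply_apply (c.1 i a)
      right_inv := by
        intro y
        ext m i a
        simp only
        rw [← Basis.equivFun_apply, LinearEquiv.apply_symm_apply] }
  rw [Nat.card_congr e, Nat.card_pi]
  simp

/-- Functionals carry the vanishing conditions to words of `C`, and together they separate the
points of `K`. The dimension follows by counting. -/
lemma IsLinearMSR.extend [Finite F] [FiniteDimensional F K] {N α β r d : ℕ}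
    {C : Submodule F (Fin N → Block F α)}
    {V : Fin N → Finset (Fin N) → Fin N → (Block F α →ₗ[F] Block F β)}
    (hC : IsLinearMSR r d C V) :
    IsLinearMSR r d (extendCode K C) (fun j D i => extendMap K (V j D i)) where
  finrank_eq := by
    have : Finite K := Module.finite_of_finite F
    have h1 := natCard_extendCode (K := K) C
    rw [natCard_eq_pow_finrank (K := F) (V := C), natCard_eq_pow_finrank (K := K),
      natCard_eq_pow_finrank (K := F) (V := K), ← pow_mul, ← pow_mul, mul_comm (finrank F C),
      hC.finrank_eq] at h1
    exact Nat.eq_of_mul_eq_mul_left finrank_pos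
      (Nat.pow_right_injective Finite.one_lt_card h1)
  eq_zero := by
    intro c hc A hA h
    ext i a
    refine eq_zero_of_functionals (F := F) fun φ => ?_
    have := hC.eq_zero _ (hc φ) A hA fun i hi => by ext a; simp [h i hi]
    exact congrFun (congrFun this i) a
  repair := by
    intro j D hj hD c hc h
    ext a
    refine eq_zero_of_functionals (F := F) fun φ => ?_
    have := hC.repair j D hj hD _ (hc φ) fun i hi => by
      rw [← functional_extendMap, h i hi]
      ext
      simp
    exact congrFun this a

lemma exists_large_extension (F : Type) [Field F] [Finite F] (L : ℕ) :
    ∃ (K : Type) (_ : Field K) (_ : Fintype K) (_ : Algebra F K), FiniteDimensional F K ∧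
      L < Nat.card K := by
  obtain ⟨p, hp⟩ := CharP.exists F
  have : Fact p.Prime := ⟨CharP.char_is_prime F p⟩
  refine ⟨FiniteField.Extension F p (L + 1), inferInstance, Fintype.ofFinite _, inferInstance,
    inferInstance, ?_⟩
  rw [FiniteField.natCard_extension]
  exact (Nat.lt_succ_self L).trans (Nat.lt_pow_self Finite.one_lt_card)

end ScalarExtension

/-! ### Subspaces in general position -/

section GenericSubspace

open Module

variable {K V : Type*} [Field K] [AddCommGroup V] [Module K V] [FiniteDimensional K V]

/-- Fewer than |K| proper subspaces do not cover the space. A vector outside all proper `U ⊔ W i`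
raises all of their dimensions at once. -/
lemma exists_subspace_sup_large {I : Type*} [Finite I] (W : I → Submodule K V)
    (hcard : Nat.card I < ENat.card K) (m : ℕ) :
    ∃ U : Submodule K V, finrank K U ≤ m ∧
      ∀ i, min (finrank K V) (m + finrank K (W i)) ≤ finrank K ↥(U ⊔ W i) := by
  classical
  have := Fintype.ofFinite I
  induction m with
  | zero => exact ⟨⊥, by simp, fun i => by rw [bot_sup_eq, zero_add]; exact min_le_right _ _⟩
  | succ m ih =>
    obtain ⟨U, hU, hW⟩ := ih
    have hss := Submodule.iUnion_ssubset_of_forall_ne_top_of_card_lt Finset.univ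
      (fun i : {i // U ⊔ W i ≠ ⊤} => U ⊔ W i) (fun i => i.2) (by
        refine lt_of_le_of_lt ?_ hcard
        rw [Nat.card_eq_fintype_card]
        exact_mod_cast Fintype.card_subtype_le _)
    obtain ⟨v, -, hv⟩ := Set.exists_of_ssubset hss
    simp only [Finset.mem_univ, Set.iUnion_true, Set.mem_iUnion, SetLike.mem_coe, Subtype.exists,
      not_exists] at hv
    refine ⟨U ⊔ Submodule.span K {v}, ?_, fun i => ?_⟩
    · have h1 := Submodule.finrank_add_le_finrank_add_finrank U (Submodule.span K {v})
      have h2 : finrank K (Submodule.span K {v}) ≤ 1 := by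
        simpa using finrank_span_le_card (R := K) ({v} : Set V)
      exact h1.trans (add_le_add hU h2)
    · have heq : U ⊔ Submodule.span K {v} ⊔ W i = (U ⊔ W i) ⊔ Submodule.span K {v} := by
        rw [sup_assoc, sup_comm _ (W i), ← sup_assoc]
      by_cases htop : U ⊔ W i = ⊤
      · rw [heq, htop, top_sup_eq, finrank_top]
        exact min_le_left _ _
      · have hlt : U ⊔ W i < U ⊔ Submodule.span K {v} ⊔ W i := by
          rw [heq]
          refine left_lt_sup.2 fun hle => hv i htop (hle (Submodule.mem_span_singleton_self v))
        have := Submodule.finrank_lt_finrank_of_lt hlt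
        have := hW i
        omega

/-- Over a large field, some subspace of dimension `m` is in general position to finitely many
given subspaces. -/
lemma exists_generic_subspace {I : Type*} [Finite I] (W : I → Submodule K V)
    (hcard : Nat.card I + 1 < Nat.card K) {m : ℕ} (hm : m ≤ finrank K V) :
    ∃ U : Submodule K V, finrank K U = m ∧
      ∀ i, (finrank K V ≤ m + finrank K (W i) → U ⊔ W i = ⊤) ∧
        (m + finrank K (W i) ≤ finrank K V → Disjoint U (W i)) := by
  have : Finite K := Nat.finite_of_card_ne_zero (by omega)
  -- The extra index with the zero subspace forces `U` to have dimension exactly `m`.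
  obtain ⟨U, hU, hW⟩ := exists_subspace_sup_large (fun i : Option I => i.elim ⊥ W) (by
    rw [Finite.card_option, ENat.card_eq_coe_natCard]
    exact_mod_cast hcard) m
  have h0 : min (finrank K V) (m + finrank K (⊥ : Submodule K V)) ≤
    finrank K ↥(U ⊔ (⊥ : Submodule K V)) := hW none
  rw [finrank_bot, add_zero, sup_bot_eq] at h0
  have hUm : finrank K U = m := by omega
  refine ⟨U, hUm, fun i => ⟨fun h => ?_, fun h => ?_⟩⟩
  · have h1 : min (finrank K V) (m + finrank K (W i)) ≤ finrank K ↥(U ⊔ W i) := hW (some i)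
    rw [min_eq_left h] at h1
    exact Submodule.eq_top_of_finrank_eq (le_antisymm (Submodule.finrank_le _) h1)
  · have h1 : min (finrank K V) (m + finrank K (W i)) ≤ finrank K ↥(U ⊔ W i) := hW (some i)
    rw [min_eq_right h] at h1
    have h2 := Submodule.finrank_sup_add_finrank_inf_eq U (W i)
    rw [disjoint_iff, ← Submodule.finrank_eq_zero (R := K)]
    omega

end GenericSubspace

/-! ### Generic subcodes of products of MSR codes -/

section Construction

open Module

open Classical in
/-- Among enough nodes there are `k` of which no group contains more than `r`. -/
lemma exists_subset_capped {g r δ k : ℕ} (hr : 1 ≤ r) (hk : 1 ≤ k)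
    (S : Finset (Node g (r + δ - 1))) (hS : k + (k - 1) / r * (δ - 1) ≤ S.card) :
    ∃ S' ⊆ S, (∀ i, (S'.filter fun t => t.1 = i).card ≤ r) ∧ k ≤ S'.card := by
  let n : Fin g → ℕ := fun i => (S.filter fun t => t.1 = i).card
  have hn : ∑ i, n i = S.card :=
    (Finset.card_eq_sum_card_fiberwise (f := Prod.fst) (t := Finset.univ) (by simp)).symm
  have hη : ∀ i, n i ≤ r + δ - 1 := by
    intro i
    calc n i ≤ (({i} : Finset (Fin g)) ×ˢ (Finset.univ : Finset (Fin (r + δ - 1)))).card := by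
          refine Finset.card_le_card fun t ht => ?_
          simp only [Finset.mem_filter] at ht
          rw [Finset.mem_product]
          simp [ht.2]
      _ = r + δ - 1 := by simp
  have hex : ∀ i, ∃ A ⊆ S.filter fun t => t.1 = i, A.card = min (n i) r :=
    fun i => Finset.exists_subset_card_eq (min_le_left _ _)
  choose A hAS hA using hex
  have hA1 : ∀ i, ∀ t ∈ A i, t.1 = i := fun i t ht => (Finset.mem_filter.1 (hAS i ht)).2
  refine ⟨Finset.univ.biUnion A, ?_, fun i => ?_, ?_⟩
  · intro t ht
    obtain ⟨i, -, hi⟩ := Finset.mem_biUnion.1 ht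
    exact (Finset.mem_filter.1 (hAS i hi)).1
  · refine (Finset.card_le_card (t := A i) fun t ht => ?_).trans ((hA i).trans_le (min_le_right _ _))
    obtain ⟨ht, hti⟩ := Finset.mem_filter.1 ht
    obtain ⟨i', -, hi'⟩ := Finset.mem_biUnion.1 ht
    rw [hA1 i' t hi'] at hti
    exact hti ▸ hi'
  · rw [Finset.card_biUnion]
    swap
    · intro i _ i' _ hii
      rw [Function.onFun, Finset.disjoint_left]
      intro t h1 h2
      exact hii ((hA1 i t h1).symm.trans (hA1 i' t h2))
    simp only [hA]
    by_contra! hlt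
    -- If fewer than k nodes are kept, at most (k - 1)/r groups keep r nodes. Each of these loses at
    -- most δ - 1 nodes, and the others lose none.
    let m := (Finset.univ.filter fun i => r ≤ n i).card
    have hm : m * r ≤ ∑ i, min (n i) r := by
      calc m * r = ∑ i ∈ Finset.univ.filter fun i => r ≤ n i, r := by simp [m]
        _ ≤ ∑ i ∈ Finset.univ.filter fun i => r ≤ n i, min (n i) r :=
            Finset.sum_le_sum fun i hi => le_min (Finset.mem_filter.1 hi).2 le_rfl
        _ ≤ ∑ i, min (n i) r := Finset.sum_le_sum_of_subset (Finset.filter_subset _ _)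
    have hm' : m ≤ (k - 1) / r := (Nat.le_div_iff_mul_le (by omega)).2 (by omega)
    have hsum : ∑ i, n i ≤ ∑ i, (min (n i) r + if r ≤ n i then δ - 1 else 0) := by
      refine Finset.sum_le_sum fun i _ => ?_
      have := hη i
      split_ifs <;> omega
    rw [Finset.sum_add_distrib, Finset.sum_ite, Finset.sum_const, Finset.sum_const_zero, hn,
      smul_eq_mul] at hsum
    change S.card ≤ (∑ i, min (n i) r) + (m * (δ - 1) + 0) at hsum
    have : m * (δ - 1) ≤ (k - 1) / r * (δ - 1) := Nat.mul_le_mul_right _ hm'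
    omega

variable {K : Type} [Field K] {g N α : ℕ}

/-- The codewords of the `g`-fold product of a local code, as vectors indexed by the nodes. -/
def productCode (g : ℕ) (C₀ : Submodule K (Fin N → Block K α)) :
    (Fin g → C₀) →ₗ[K] (Node g N → Block K α) where
  toFun c t := (c t.1).1 t.2
  map_add' _ _ := rfl
  map_smul' _ _ := rfl

lemma productCode_injective (C₀ : Submodule K (Fin N → Block K α)) :
    Function.Injective (productCode g C₀) := by
  intro c c' h
  ext i p a
  exact congrFun (congrFun h (i, p)) a

/-- The restriction of the product code to the nodes in `S`. -/
def productRestrict (C₀ : Submodule K (Fin N → Block K α)) (S : Finset (Node g N)) :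
    (Fin g → C₀) →ₗ[K] (S → Block K α) :=
  (LinearMap.funLeft K (Block K α) (Subtype.val : S → Node g N)).comp (productCode g C₀)

/-- The groups are independent in the product, and up to r nodes of an MDS code can be prescribed.
This gives the exact dimension of the kernel. -/
lemma productRestrict_surjective {r d β : ℕ} {C₀ : Submodule K (Fin N → Block K α)}
    {V₀ : Fin N → Finset (Fin N) → Fin N → (Block K α →ₗ[K] Block K β)}
    (h₀ : IsLinearMSR r d C₀ V₀) (hN : r ≤ N) (S : Finset (Node g N))
    (hS : ∀ i, (S.filter fun t => t.1 = i).card ≤ r) :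
    Function.Surjective (productRestrict C₀ S) := by
  classical
  intro x
  have hex : ∀ i : Fin g, ∃ c ∈ C₀, ∀ p (hp : (i, p) ∈ S), c p = x ⟨(i, p), hp⟩ := by
    intro i
    obtain ⟨c, hc, h⟩ := h₀.exists_extending hN ((S.filter fun t => t.1 = i).image Prod.snd)
      (Finset.card_image_le.trans (hS i))
      (fun p => if hp : (i, p) ∈ S then x ⟨(i, p), hp⟩ else 0)
    refine ⟨c, hc, fun p hp => ?_⟩
    rw [h p (Finset.mem_image.2 ⟨(i, p), by simp [hp], rfl⟩), dif_pos hp]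
  choose c hc hcx using hex
  refine ⟨fun i => ⟨c i, hc i⟩, ?_⟩
  funext ⟨⟨i, p⟩, ht⟩
  exact hcx i p ht

open Classical in
/-- Over a large field, a generic subcode of a product of MSR codes is an MSR-LRC with the largest
possible minimum distance. -/
lemma exists_linear_isMSRLRC [Fintype K] {r δ d k β dmin : ℕ}
    {C₀ : Submodule K (Fin (r + δ - 1) → Block K α)}
    {V₀ : Fin (r + δ - 1) → Finset (Fin (r + δ - 1)) → Fin (r + δ - 1) →
      (Block K α →ₗ[K] Block K β)}
    (h₀ : IsLinearMSR r d C₀ V₀) (hr : 1 ≤ r) (hα : 1 ≤ α) (hrd : r ≤ d) (hd : d + 1 ≤ r + δ - 1)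
    (hbw : (d - r + 1) * β = α) (hrk : r ≤ k) (hkg : k ≤ g * r)
    (hdmin : dmin + k + (k - 1) / r * (δ - 1) = g * (r + δ - 1) + 1)
    (hcard : 2 ^ (g * (r + δ - 1)) + g + 1 < Nat.card K) :
    ∃ C : Submodule K (Node g (r + δ - 1) → Block K α), finrank K C = k * α ∧
      IsMSRLRC (F := K) r δ d dmin (C : Set (Node g (r + δ - 1) → Block K α))
        (fun _ j D p => V₀ j D p) := by
  have hdimV : finrank K (Fin g → C₀) = g * r * α := by
    rw [finrank_pi_fintype]
    simp [h₀.finrank_eq, mul_assoc]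
  -- Avoiding the kernels of restrictions bounds the distance from below; spanning with the kernels
  -- of projections, possible as r ≤ k, makes every local code all of `C₀`.
  obtain ⟨U, hU, hgen⟩ := exists_generic_subspace
    (I := Finset (Node g (r + δ - 1)) ⊕ Fin g) (V := Fin g → C₀)
    (Sum.elim (fun S => LinearMap.ker (productRestrict C₀ S))
      (fun i => LinearMap.ker (LinearMap.proj (R := K) (φ := fun _ : Fin g => C₀) i)))
    (by rw [Nat.card_sum]; simpa [Nat.card_eq_fintype_card] using hcard)
    (m := k * α) (by rw [hdimV]; exact Nat.mul_le_mul_right _ hkg)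
  have hgenS : ∀ S : Finset (Node g (r + δ - 1)),
      k * α + finrank K (LinearMap.ker (productRestrict C₀ S)) ≤ finrank K (Fin g → C₀) →
        Disjoint U (LinearMap.ker (productRestrict C₀ S)) := fun S => (hgen (Sum.inl S)).2
  have hgenI : ∀ i : Fin g, finrank K (Fin g → C₀) ≤ k * α +
      finrank K (LinearMap.ker (LinearMap.proj (R := K) (φ := fun _ : Fin g => C₀) i)) →
        U ⊔ LinearMap.ker (LinearMap.proj (R := K) (φ := fun _ : Fin g => C₀) i) = ⊤ :=
    fun i => (hgen (Sum.inr i)).1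
  have hdimC : finrank K (U.map (productCode g C₀)) = k * α := by
    rw [← hU]
    exact (LinearEquiv.finrank_eq
      (Submodule.equivMapOfInjective _ (productCode_injective C₀) U)).symm
  refine ⟨U.map (productCode g C₀), hdimC, ?_, ?_⟩
  · intro i
    have hloc : localCode ((U.map (productCode g C₀) : Submodule K _) : Set _) i
        = (C₀ : Set (Fin (r + δ - 1) → Block K α)) := by
      ext x
      constructor
      · rintro ⟨_, ⟨c, -, rfl⟩, rfl⟩
        exact (c i).2
      · intro hx
        have hsup : U ⊔ LinearMap.ker (LinearMap.proj (R := K) (φ := fun _ : Fin g => C₀) i) = ⊤ := by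
          refine hgenI i ?_
          have h1 := LinearMap.finrank_range_add_finrank_ker
            (LinearMap.proj (R := K) (φ := fun _ : Fin g => C₀) i)
          rw [LinearMap.range_eq_top.2 (LinearMap.proj_surjective i), finrank_top,
            h₀.finrank_eq] at h1
          have : r * α ≤ k * α := Nat.mul_le_mul_right _ hrk
          omega
        have hmem : (fun _ => ⟨x, hx⟩ : Fin g → C₀) ∈
            U ⊔ LinearMap.ker (LinearMap.proj (R := K) (φ := fun _ : Fin g => C₀) i) := by
          rw [hsup]; trivial
        obtain ⟨u, hu, w, hw, huw⟩ := Submodule.mem_sup.1 hmem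
        refine ⟨_, ⟨u, hu, rfl⟩, ?_⟩
        have h1 := congrFun huw i
        rw [Pi.add_apply, show w i = 0 from hw, add_zero] at h1
        change (u i).1 = x
        rw [h1]
    rw [hloc]
    exact h₀.isMSRCode hr hα hrd hd hbw
  · refine hasMinDist_of_linear _ ?_ ?_
    · rintro _ ⟨c, hc, rfl⟩ S hS h
      obtain ⟨S', hS'S, hS'r, hkS'⟩ := exists_subset_capped hr (hr.trans hrk) S (by
        have : Fintype.card (Node g (r + δ - 1)) = g * (r + δ - 1) := by simp
        omega)
      have hdis : Disjoint U (LinearMap.ker (productRestrict C₀ S')) := by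
        refine hgenS S' ?_
        have h1 := LinearMap.finrank_range_add_finrank_ker (productRestrict C₀ S')
        rw [LinearMap.range_eq_top.2 (productRestrict_surjective h₀ (by omega) S' hS'r),
          finrank_top, finrank_pi_block] at h1
        have : k * α ≤ S'.card * α := Nat.mul_le_mul_right _ hkS'
        omega
      have : c = 0 := by
        refine Submodule.disjoint_def.1 hdis c hc (LinearMap.mem_ker.2 ?_)
        funext t
        exact h t (hS'S t.2)
      rw [this, map_zero]
    · have hag : (k - 1) / r < g := by
        rw [Nat.div_lt_iff_lt_mul (by omega)]; omega
      set a := (k - 1) / r with ha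
      have hb : (k - 1) % r < r := Nat.mod_lt _ (by omega)
      have hdm := Nat.div_add_mod (k - 1) r
      rw [← ha] at hdm
      set b := (k - 1) % r
      have hrη : r ≤ r + δ - 1 := by omega
      -- With k - 1 = ra + b, `S r` has k - 1 nodes, so some nonzero codeword vanishes there. By the
      -- local MDS property it vanishes on `S (r + δ - 1)`, which has n - dmin nodes.
      let S : ℕ → Finset (Node g (r + δ - 1)) := fun m =>
        (Finset.univ.filter fun i : Fin g => i.1 < a) ×ˢ
          (Finset.univ.filter fun p : Fin (r + δ - 1) => p.1 < m) ∪
          {⟨a, hag⟩} ×ˢ (Finset.univ.filter fun p : Fin (r + δ - 1) => p.1 < b)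
      have hcardS : ∀ m ≤ r + δ - 1, (S m).card = a * m + b := by
        intro m hm
        rw [Finset.card_union_of_disjoint]
        · rw [Finset.card_product, Finset.card_product, card_filter_val_lt_of_le hag.le,
            card_filter_val_lt_of_le hm, card_filter_val_lt_of_le (by omega),
            Finset.card_singleton, one_mul]
        · rw [Finset.disjoint_left]
          rintro t h1 h2
          simp only [Finset.mem_product, Finset.mem_filter, Finset.mem_univ, true_and,
            Finset.mem_singleton, Fin.ext_iff] at h1 h2
          omega
      obtain ⟨_, ⟨c, hcU, rfl⟩, hne, hc⟩ := exists_ne_zero_vanishing (U.map (productCode g C₀)) (S r) (by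
        rw [hcardS r hrη, hdimC]
        refine Nat.mul_lt_mul_of_pos_right ?_ hα
        rw [mul_comm]; omega)
      refine ⟨_, ⟨c, hcU, rfl⟩, hne, S (r + δ - 1), ?_, ?_⟩
      · rw [hcardS _ le_rfl]
        have h1 : a * (r + δ - 1) = r * a + a * (δ - 1) := by
          rw [mul_comm r, ← mul_add]; congr 1; omega
        have h2 : Fintype.card (Node g (r + δ - 1)) = g * (r + δ - 1) := by simp
        omega
      · rintro ⟨i, p⟩ ht
        by_cases hi : i.1 < a
        · have h0 := h₀.eq_zero (c i).1 (c i).2 (Finset.univ.filter fun p => p.1 < r)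
            (card_filter_val_lt_of_le hrη) (fun p hp => hc (i, p) (by
              simp only [Finset.mem_filter, Finset.mem_univ, true_and] at hp
              simp [S, hi, hp]))
          exact congrFun h0 p
        · refine hc (i, p) ?_
          simp only [S, Finset.mem_union, Finset.mem_product, Finset.mem_filter, Finset.mem_univ,
            true_and, hi, false_and, false_or] at ht ⊢
          exact ht

end Construction

/-! ### Coset coding -/

section SecureEncoding

open Module

/-- The bijections make the conditional law of `Y` the same for every file. -/
lemma qMutualInfo_fst_eq_zero {A B T : Type*} [Fintype A] [Fintype B] (q : ℕ) (Y : A × B → T)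
    (h : ∀ a a', ∃ e : B ≃ B, ∀ b, Y (a, b) = Y (a', e b)) :
    qMutualInfo q (fun x : A × B => x.1) Y = 0 := by
  refine qMutualInfo_eq_zero_of_indep q _ _ fun ω => ?_
  obtain ⟨a₀, b₀⟩ := ω
  generalize hy : Y (a₀, b₀) = y
  have : Nonempty A := ⟨a₀⟩
  have : Nonempty B := ⟨b₀⟩
  have h1 : Nat.card {x : A × B // (x.1, Y x) = (a₀, y)} = Nat.card {b // Y (a₀, b) = y} :=
    Nat.card_congr
      { toFun := fun x => ⟨x.1.2, by
          obtain ⟨⟨a, b⟩, hx⟩ := x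
          obtain ⟨h1, h2⟩ := Prod.mk.inj hx
          change Y (a₀, b) = y
          rw [← h1]
          exact h2⟩
        invFun := fun b => ⟨(a₀, b.1), by simp [b.2]⟩
        left_inv := by
          rintro ⟨⟨a, b⟩, hx⟩
          obtain ⟨rfl, -⟩ := Prod.mk.inj hx
          rfl
        right_inv := fun _ => rfl }
  choose e he using fun a => h a a₀
  have h2 : Nat.card {x // Y x = y} = Nat.card A * Nat.card {b // Y (a₀, b) = y} := by
    rw [← Nat.card_prod]
    exact Nat.card_congr
      { toFun := fun x => (x.1.1, ⟨e x.1.1 x.1.2, by rw [← he]; exact x.2⟩)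
        invFun := fun z => ⟨(z.1, (e z.1).symm z.2.1), by
          rw [he, Equiv.apply_symm_apply]; exact z.2.2⟩
        left_inv := fun x => by simp
        right_inv := fun z => by simp }
  have h3 : Nat.card {x : A × B // x.1 = a₀} = Nat.card B := natCard_fst_fiber a₀
  have hA : (Nat.card A : ℝ) ≠ 0 := by exact_mod_cast Nat.card_pos.ne'
  have hB : (Nat.card B : ℝ) ≠ 0 := by exact_mod_cast Nat.card_pos.ne'
  unfold uniformProb
  rw [h1, h2, h3, ← Nat.card_eq_fintype_card, Nat.card_prod]
  push_cast
  field_simp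

variable {K : Type} [Field K] {g η α β : ℕ}

/-- The content of the nodes in `E₁` and the symbols downloaded in the repair of the nodes
in `E₂`, as a linear map on the codewords. -/
def downloads (C : Submodule K (Node g η → Block K α))
    (V : Fin g → Fin η → Finset (Fin η) → Fin η → (Block K α →ₗ[K] Block K β))
    (E₁ E₂ : Finset (Node g η)) (D : Node g η → Finset (Fin η)) :
    C →ₗ[K] (E₁ → Block K α) × ((j : E₂) → D j.1 → Block K β) :=
  LinearMap.prod (restrictTo C E₁)
    (LinearMap.pi fun j => LinearMap.pi fun p =>
      (V j.1.1 j.1.2 (D j.1) p.1).comp ((LinearMap.proj (j.1.1, p.1)).comp C.subtype))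

lemma finrank_downloads {d : ℕ} (E₁ E₂ : Finset (Node g η)) (D : Node g η → Finset (Fin η))
    (hD : ∀ j ∈ E₂, (D j).card = d) :
    finrank K ((E₁ → Block K α) × ((j : E₂) → D j.1 → Block K β))
      = E₁.card * α + E₂.card * (d * β) := by
  rw [finrank_prod, finrank_pi_block, finrank_pi_fintype]
  congr 1
  have : ∀ j : E₂, finrank K (D j.1 → Block K β) = d * β := by
    intro j
    rw [finrank_pi_block, hD j j.2]
  rw [Finset.sum_congr rfl fun j _ => this j]
  simp

/-- Coset coding: the random symbols fill a generic subcode, which hides the secure file. -/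
lemma exists_secure_encoder [Fintype K] {d ℓ₁ ℓ₂ Ms : ℕ} (C : Submodule K (Node g η → Block K α))
    (V : Fin g → Fin η → Finset (Fin η) → Fin η → (Block K α →ₗ[K] Block K β))
    (hdim : finrank K C = Ms + (ℓ₁ * α + ℓ₂ * (d * β)))
    (hrep : ∀ (i : Fin g) (j : Fin η) (D : Finset (Fin η)), j ∉ D → D.card = d →
      ∀ c ∈ C, (∀ p ∈ D, V i j D p (c (i, p)) = 0) → c (i, j) = 0)
    (hcard : Nat.card (Finset (Node g η) × Finset (Node g η) × (Node g η → Finset (Fin η))) + 1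
      < Nat.card K) :
    ∃ enc : (Fin Ms → K) × (Fin (ℓ₁ * α + ℓ₂ * (d * β)) → K) → Node g η → Block K α,
      Function.Injective enc ∧ Set.range enc = (C : Set (Node g η → Block K α)) ∧
        IsSecure d ℓ₁ ℓ₂ enc (fun i j D p => V i j D p) := by
  obtain ⟨U, hU, hgen⟩ := exists_generic_subspace (V := C)
    (fun x : Finset (Node g η) × Finset (Node g η) × (Node g η → Finset (Fin η)) =>
      LinearMap.ker (downloads C V x.1 x.2.1 x.2.2)) hcard
    (m := ℓ₁ * α + ℓ₂ * (d * β)) (by omega)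
  obtain ⟨W, hW⟩ := Submodule.exists_isCompl U
  have hWdim : finrank K W = Ms := by
    have := Submodule.finrank_add_eq_of_isCompl hW
    omega
  have : Module.Free K W := Module.Free.of_divisionRing K W
  have : Module.Free K U := Module.Free.of_divisionRing K U
  let eW : (Fin Ms → K) ≃ₗ[K] W := LinearEquiv.ofFinrankEq _ _ (by simp [hWdim])
  let eU : (Fin (ℓ₁ * α + ℓ₂ * (d * β)) → K) ≃ₗ[K] U :=
    LinearEquiv.ofFinrankEq _ _ (by simp [hU])
  let e : ((Fin Ms → K) × (Fin (ℓ₁ * α + ℓ₂ * (d * β)) → K)) ≃ₗ[K] C :=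
    (eW.prodCongr eU).trans (Submodule.prodEquivOfIsCompl W U hW.symm)
  refine ⟨fun f => (e f).1, Subtype.val_injective.comp e.injective, ?_, ?_⟩
  · ext c
    constructor
    · rintro ⟨f, rfl⟩
      exact (e f).2
    · intro hc
      exact ⟨e.symm ⟨c, hc⟩, by simp⟩
  intro E₁ E₂ D hE₁ hE₂ hD
  -- The rank of the observation is at most dim `U`, so the dimensions of `U` and the kernel add up
  -- to at least that of `C`.
  have hsup : U ⊔ LinearMap.ker (downloads C V E₁ E₂ D) = ⊤ := by
    refine (hgen (E₁, E₂, D)).1 ?_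
    have h1 := LinearMap.finrank_range_add_finrank_ker (downloads C V E₁ E₂ D)
    have h2 := Submodule.finrank_le (LinearMap.range (downloads C V E₁ E₂ D))
    rw [finrank_downloads E₁ E₂ D fun j hj => (hD j hj).2, hE₁, hE₂] at h2
    change _ ≤ _ + finrank K (LinearMap.ker (downloads C V E₁ E₂ D))
    omega
  have hker : ∀ c w : C, w ∈ LinearMap.ker (downloads C V E₁ E₂ D) →
      observation (fun i j D p => V i j D p) E₁ E₂ D (c + w).1
        = observation (fun i j D p => V i j D p) E₁ E₂ D c.1 := by
    intro c w hw
    have hw1 : ∀ j ∈ E₁, w.1 j = 0 := fun j hj =>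
      congrFun (congrArg Prod.fst (LinearMap.mem_ker.1 hw)) ⟨j, hj⟩
    have hw2 : ∀ j ∈ E₂, ∀ p ∈ D j, V j.1 j.2 (D j) p (w.1 (j.1, p)) = 0 := fun j hj p hp =>
      congrFun (congrFun (congrArg Prod.snd (LinearMap.mem_ker.1 hw)) ⟨j, hj⟩) ⟨p, hp⟩
    -- `downloads` omits the contents of `E₂`; linear exact repair recovers them.
    have hw3 : ∀ j ∈ E₂, w.1 j = 0 := fun j hj =>
      hrep j.1 j.2 (D j) (hD j hj).1 (hD j hj).2 w.1 w.2 (hw2 j hj)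
    refine Prod.ext ?_ ?_
    · funext ⟨j, hj⟩
      change c.1 j + w.1 j = c.1 j
      rw [hw1 j hj, add_zero]
    · funext ⟨j, hj⟩
      refine Prod.ext ?_ ?_
      · change c.1 j + w.1 j = c.1 j
        rw [hw3 j hj, add_zero]
      · funext ⟨p, hp⟩
        change V j.1 j.2 (D j) p (c.1 (j.1, p) + w.1 (j.1, p)) = V j.1 j.2 (D j) p (c.1 (j.1, p))
        rw [map_add, hw2 j hj p hp, add_zero]
  refine qMutualInfo_fst_eq_zero _ _ fun a a' => ?_
  -- Exchanging `a'` for `a` adds `u + w` to the codeword: a shift of the random symbols absorbs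
  -- `u`, and `w` is invisible.
  have hmem : e (a - a', 0) ∈ U ⊔ LinearMap.ker (downloads C V E₁ E₂ D) := by
    rw [hsup]; trivial
  obtain ⟨u, hu, w, hw, huw⟩ := Submodule.mem_sup.1 hmem
  have heu : e (0, eU.symm ⟨u, hu⟩) = u := by
    simp [e, Submodule.coe_prodEquivOfIsCompl']
  refine ⟨Equiv.addRight (eU.symm ⟨u, hu⟩), fun b => ?_⟩
  have hsplit : e (a, b) = e (a', b + eU.symm ⟨u, hu⟩) + w := by
    have h1 : ((a, b) : (Fin Ms → K) × (Fin (ℓ₁ * α + ℓ₂ * (d * β)) → K))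
        = (a', b) + (a - a', 0) := by simp
    have h2 : ((a', b + eU.symm ⟨u, hu⟩) : (Fin Ms → K) × (Fin (ℓ₁ * α + ℓ₂ * (d * β)) → K))
        = (a', b) + (0, eU.symm ⟨u, hu⟩) := by simp
    rw [h1, h2, map_add, map_add, heu, ← huw, add_assoc]
  change observation _ E₁ E₂ D (e (a, b)).1 = observation _ E₁ E₂ D (e (a', b + _)).1
  rw [hsplit]
  exact hker _ w hw

end SecureEncoding

/-! ### Parameters of optimal codes and achievability -/

section Capacity

open Module

lemma ceilDiv_eq_of_lt_of_le {t a M : ℕ} (h1 : t * a < M) (h2 : M ≤ (t + 1) * a) :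
    M ⌈/⌉ a = t + 1 := by
  have ha : 0 < a := by
    rcases Nat.eq_zero_or_pos a with rfl | h
    · omega
    · exact h
  rw [Nat.ceilDiv_eq_add_pred_div, Nat.div_eq_iff ha]
  rw [add_mul, one_mul] at *
  omega

/-- Both ceilings depend only on k = ⌈M/α⌉, so rounding the file size up to kα preserves optimality.
-/
lemma isDminOptimal_iff {n k M r δ α dmin : ℕ} (hr : 1 ≤ r) (hδ : 1 ≤ δ) (hk : 1 ≤ k)
    (h1 : (k - 1) * α < M) (h2 : M ≤ k * α) :
    IsDminOptimal n M r δ α dmin ↔ dmin + k + (k - 1) / r * (δ - 1) = n + 1 := by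
  have hdm := Nat.div_add_mod (k - 1) r
  have hml := Nat.mod_lt (k - 1) hr
  have hα : M ⌈/⌉ α = k := by
    have := ceilDiv_eq_of_lt_of_le h1 (by rwa [Nat.sub_add_cancel hk])
    rwa [Nat.sub_add_cancel hk] at this
  have hrα : M ⌈/⌉ (r * α) = (k - 1) / r + 1 := by
    refine ceilDiv_eq_of_lt_of_le (lt_of_le_of_lt ?_ h1) (h2.trans ?_)
    · rw [← mul_assoc]
      refine Nat.mul_le_mul_right _ ?_
      rw [mul_comm]; omega
    · rw [← mul_assoc]
      refine Nat.mul_le_mul_right _ ?_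
      rw [add_mul, one_mul, mul_comm]; omega
  rw [IsDminOptimal, hα, hrα]
  zify [hδ]
  constructor <;> intro h <;> linarith

/-- If k - 1 = ra + b with b < r, then n - dmin + 1 = (r + δ - 1)a + (b + 1), so μ = a and h = b + 1
≤ r. -/
lemma mul_add_min_eq_of_optimal {g r δ k dmin μ h : ℕ} (hr : 1 ≤ r) (hδ : 2 ≤ δ) (hk : 1 ≤ k)
    (hdn : dmin ≤ g * (r + δ - 1))
    (hdmin : dmin + k + (k - 1) / r * (δ - 1) = g * (r + δ - 1) + 1)
    (hμ : μ = (g * (r + δ - 1) - dmin + 1) / (r + δ - 1))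
    (hh : h = (g * (r + δ - 1) - dmin + 1) - (r + δ - 1) * μ) :
    μ * r + min h r = k := by
  have hdm := Nat.div_add_mod (k - 1) r
  have hml := Nat.mod_lt (k - 1) hr
  set a := (k - 1) / r
  set b := (k - 1) % r
  have hm : g * (r + δ - 1) - dmin + 1 = (r + δ - 1) * a + (b + 1) := by
    have : (r + δ - 1) * a = r * a + a * (δ - 1) := by
      rw [mul_comm a, ← add_mul]; congr 1; omega
    omega
  have hμa : μ = a := by
    rw [hμ, hm, Nat.mul_add_div (by omega), Nat.div_eq_of_lt (by omega), add_zero]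
  rw [hμa, hm, Nat.add_sub_cancel_left] at hh
  rw [hh, hμa, min_eq_left (by omega), mul_comm]
  omega

/-- A linear MSR code over some field gives MSR-LRCs over all sufficiently large extensions. -/
lemma exists_isMSRLRC_of_isLinearMSR {F : Type} [Field F] [Finite F] {g r δ d k α β dmin : ℕ}
    {C₀ : Submodule F (Fin (r + δ - 1) → Block F α)}
    {V₀ : Fin (r + δ - 1) → Finset (Fin (r + δ - 1)) → Fin (r + δ - 1) →
      (Block F α →ₗ[F] Block F β)}
    (h₀ : IsLinearMSR r d C₀ V₀) (hr : 1 ≤ r) (hα : 1 ≤ α) (hrd : r ≤ d) (hd : d + 1 ≤ r + δ - 1)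
    (hbw : (d - r + 1) * β = α) (hrk : r ≤ k) (hkg : k ≤ g * r)
    (hdmin : dmin + k + (k - 1) / r * (δ - 1) = g * (r + δ - 1) + 1) (L : ℕ) :
    ∃ (K : Type) (_ : Field K) (_ : Fintype K)
      (C : Submodule K (Node g (r + δ - 1) → Block K α))
      (V : Fin g → Fin (r + δ - 1) → Finset (Fin (r + δ - 1)) → Fin (r + δ - 1) →
        (Block K α →ₗ[K] Block K β)),
      L < Nat.card K ∧ finrank K C = k * α ∧
      IsMSRLRC (F := K) (β := β) r δ d dmin (C : Set (Node g (r + δ - 1) → Block K α))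
        (fun i j D p => V i j D p) := by
  obtain ⟨K, _, _, _, _, hK⟩ := exists_large_extension F (L + (2 ^ (g * (r + δ - 1)) + g + 1))
  obtain ⟨C, hC, hLRC⟩ := exists_linear_isMSRLRC (g := g) (k := k) (dmin := dmin)
    (h₀.extend (K := K)) hr hα hrd hd hbw hrk hkg hdmin ((Nat.le_add_left _ _).trans_lt hK)
  exact ⟨K, inferInstance, inferInstance, C, _, (Nat.le_add_right _ _).trans_lt hK, hC, hLRC⟩

lemma existsLinearMSRLRC_of_isLinearMSR {F : Type} [Field F] [Finite F] {g r δ d k α β dmin : ℕ}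
    {C₀ : Submodule F (Fin (r + δ - 1) → Block F α)}
    {V₀ : Fin (r + δ - 1) → Finset (Fin (r + δ - 1)) → Fin (r + δ - 1) →
      (Block F α →ₗ[F] Block F β)}
    (h₀ : IsLinearMSR r d C₀ V₀) (hr : 1 ≤ r) (hδ : 1 ≤ δ) (hα : 1 ≤ α) (hrd : r ≤ d)
    (hd : d + 1 ≤ r + δ - 1) (hbw : (d - r + 1) * β = α) (hrk : r ≤ k) (hkg : k ≤ g * r)
    (hopt : IsDminOptimal (g * (r + δ - 1)) (k * α) r δ α dmin) :
    ExistsLinearMSRLRC g r δ α β d dmin := by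
  have hk : 1 ≤ k := hr.trans hrk
  have hlt : (k - 1) * α < k * α := Nat.mul_lt_mul_of_pos_right (by omega) hα
  obtain ⟨K, hK, hK', C, V, -, hC, hLRC⟩ := exists_isMSRLRC_of_isLinearMSR (g := g) h₀ hr hα hrd hd
    hbw hrk hkg ((isDminOptimal_iff hr hδ hk hlt le_rfl).1 hopt) 0
  exact ⟨K, hK, hK', C, V, hLRC, by rw [hC]; exact hopt⟩

lemma IsMSRLRC.repair_linear {F : Type} [Field F] [Fintype F] {g r δ d dmin α β : ℕ}
    {C : Submodule F (Node g (r + δ - 1) → Block F α)}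
    {V : Fin g → Fin (r + δ - 1) → Finset (Fin (r + δ - 1)) → Fin (r + δ - 1) →
        (Block F α →ₗ[F] Block F β)}
    (h : IsMSRLRC (F := F) (β := β) r δ d dmin (C : Set (Node g (r + δ - 1) → Block F α))
        (fun i j D p => V i j D p)) (i : Fin g) (j : Fin (r + δ - 1))
    (D : Finset (Fin (r + δ - 1))) (hj : j ∉ D) (hD : D.card = d) (c) (hc : c ∈ C)
    (h0 : ∀ p ∈ D, V i j D p (c (i, p)) = 0) : c (i, j) = 0 := by
  obtain ⟨ψ, hψ⟩ := (h.localMSR i).repair j D hj hD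
  have h1 : c (i, j) = ψ fun p => V i j D p (c (i, p)) := hψ _ ⟨c, hc, rfl⟩
  have h2 := hψ _ ⟨0, C.zero_mem, rfl⟩
  simp only [Pi.zero_apply] at h2
  rw [h1, h2]
  congr 1
  funext p
  rw [h0 p p.2, map_zero]

/-- The restriction of a linear LRC to a local group. -/
def localSubmodule {F : Type} [Field F] {g η α : ℕ} (C : Submodule F (Node g η → Block F α))
    (i : Fin g) : Submodule F (Fin η → Block F α) :=
  C.map (LinearMap.funLeft F (Block F α) (fun p => (i, p)))

/-- The field of the given code may be too small and its dimension M no multiple of α, so only a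
local code and k = ⌈M/α⌉ are kept. The bounds on k come from rα ≤ M ≤ grα. -/
lemma exists_isLinearMSR_of_existsLinearMSRLRC {g r δ α β d dmin : ℕ} (hr : 1 ≤ r)
    (hδ : 1 ≤ δ) (hα : 1 ≤ α) (h : ExistsLinearMSRLRC g r δ α β d dmin) :
    ∃ (F : Type) (_ : Field F) (_ : Fintype F) (C₀ : Submodule F (Fin (r + δ - 1) → Block F α))
      (V₀ : Fin (r + δ - 1) → Finset (Fin (r + δ - 1)) → Fin (r + δ - 1) →
        (Block F α →ₗ[F] Block F β)) (k : ℕ),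
      IsLinearMSR r d C₀ V₀ ∧ r ≤ k ∧ k ≤ g * r ∧ dmin ≤ g * (r + δ - 1) ∧
        dmin + k + (k - 1) / r * (δ - 1) = g * (r + δ - 1) + 1 := by
  obtain ⟨F, _, _, C, V, hLRC, hopt⟩ := h
  have hcardn : Fintype.card (Node g (r + δ - 1)) = g * (r + δ - 1) := by simp
  have hdn := hLRC.minDist.le_card
  have hd0 := hLRC.minDist.pos
  rw [hcardn] at hdn
  have hg : 0 < g := by
    rcases Nat.eq_zero_or_pos g with rfl | hg
    · omega
    · exact hg
  have hmsr : ∀ i, IsLinearMSR r d (localSubmodule C i) (V i) :=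
    fun i => (hLRC.localMSR i).isLinearMSR
  have hM1 : r * α ≤ finrank F C := by
    rw [← (hmsr ⟨0, hg⟩).finrank_eq]
    exact Submodule.finrank_map_le _ _
  have hM2 : finrank F C ≤ g * r * α := by
    let T : Finset (Node g (r + δ - 1)) :=
      Finset.univ ×ˢ (Finset.univ.filter fun p : Fin (r + δ - 1) => p.1 < r)
    have hT : T.card = g * r := by
      rw [Finset.card_product, card_filter_val_lt_of_le (by omega)]
      simp
    have hinj : Function.Injective (restrictTo C T) := by
      rw [← LinearMap.ker_eq_bot, LinearMap.ker_eq_bot']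
      intro c hc
      ext ⟨i, p⟩ : 2
      refine congrFun ((hmsr i).eq_zero (fun p => c.1 (i, p)) ⟨c, c.2, rfl⟩
        (Finset.univ.filter fun p => p.1 < r) (card_filter_val_lt_of_le (by omega))
        fun p hp => ?_) p
      exact congrFun hc ⟨(i, p), by simpa [T] using hp⟩
    have := LinearMap.finrank_le_finrank_of_injective hinj
    rwa [finrank_pi_block, hT] at this
  have hMpos : 1 ≤ finrank F C := le_trans (Nat.mul_pos hr hα) hM1
  set M := finrank F C
  have hdm := Nat.div_add_mod (M - 1) α
  have hml := Nat.mod_lt (M - 1) hα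
  have hk1 : (M - 1) / α * α < M := by
    rw [mul_comm]; omega
  have hk2 : M ≤ ((M - 1) / α + 1) * α := by
    rw [add_mul, one_mul, mul_comm]; omega
  refine ⟨F, inferInstance, inferInstance, localSubmodule C ⟨0, hg⟩, V ⟨0, hg⟩, (M - 1) / α + 1,
    hmsr _, ?_, ?_, hdn, ?_⟩
  · exact Nat.le_of_mul_le_mul_right (hM1.trans hk2) hα
  · exact Nat.lt_of_mul_lt_mul_right (hk1.trans_le hM2)
  · exact (isDminOptimal_iff hr hδ (Nat.le_add_left 1 _) (by simpa using hk1) hk2).1 hopt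

lemma mem_secureFileSizesOptimal {g r δ α β d dmin μ h ℓ₁ ℓ₂ : ℕ} (hr : 1 ≤ r) (hδ : 2 < δ)
    (hα1 : 1 ≤ α) (hd : r ≤ d) (hd' : d ≤ r + δ - 2) (hα : α = (d - r + 1) * β)
    (hμ : μ = (g * (r + δ - 1) - dmin + 1) / (r + δ - 1))
    (hh : h = (g * (r + δ - 1) - dmin + 1) - (r + δ - 1) * μ)
    (hℓ : ℓ₂ * r + ℓ₁ ≤ μ * r + min h r) (hex : ExistsLinearMSRLRC g r δ α β d dmin) :
    ∃ Ms ∈ secureFileSizesOptimal g r δ α β d dmin ℓ₁ ℓ₂,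
      (Ms : ℤ) = ((μ : ℤ) * r + min h r - ℓ₂ - ℓ₁) * α - ℓ₂ * ((r : ℤ) - 1) * β := by
  obtain ⟨F, _, _, C₀, V₀, k, h₀, hrk, hkg, hdn, hdmin⟩ :=
    exists_isLinearMSR_of_existsLinearMSRLRC hr (by omega) hα1 hex
  have hk : 1 ≤ k := hr.trans hrk
  have hμk := mul_add_min_eq_of_optimal hr (by omega) hk hdn hdmin hμ hh
  obtain ⟨K, _, _, C, V, hcard, hdim, hLRC⟩ := exists_isMSRLRC_of_isLinearMSR (g := g) h₀ hr hα1 hd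
    (by omega) hα.symm hrk hkg hdmin
    (Nat.card (Finset (Node g (r + δ - 1)) × Finset (Node g (r + δ - 1)) ×
      (Node g (r + δ - 1) → Finset (Fin (r + δ - 1)))) + 1)
  -- One watched repair costs exactly what the converse charges for it.
  have hdβ : d * β = α + (r - 1) * β := by
    rw [hα, ← add_mul]; congr 1; omega
  have hR : ℓ₁ * α + ℓ₂ * (d * β) ≤ k * α := by
    have hβα : β ≤ α := by
      rw [hα, add_mul, one_mul]; omega
    have h1 : d * β ≤ r * α := by
      calc d * β = α + (r - 1) * β := hdβ
        _ ≤ α + (r - 1) * α := by gcongr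
        _ = r * α := by
            obtain ⟨r, rfl⟩ : ∃ r', r = r' + 1 := ⟨r - 1, by omega⟩
            simp; ring
    calc ℓ₁ * α + ℓ₂ * (d * β) ≤ ℓ₁ * α + ℓ₂ * (r * α) := by gcongr
      _ = (ℓ₂ * r + ℓ₁) * α := by ring
      _ ≤ k * α := by rw [← hμk]; gcongr
  obtain ⟨Ms, hMs⟩ := Nat.exists_eq_add_of_le' hR
  rw [hMs] at hdim
  obtain ⟨enc, hinj, hrange, hsec⟩ := exists_secure_encoder C V hdim hLRC.repair_linear hcard
  refine ⟨Ms, ⟨K, inferInstance, inferInstance, _, enc, _, hinj, ?_, ?_, hsec⟩, ?_⟩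
  · rw [hrange]
    exact hLRC
  · rw [← hMs]
    exact (isDminOptimal_iff hr (by omega) hk
      (Nat.mul_lt_mul_of_pos_right (by omega) hα1) le_rfl).2 hdmin
  · have h1 := congrArg (Nat.cast : ℕ → ℤ) hMs
    rw [hdβ, ← hμk] at h1
    push_cast [Nat.cast_sub hr] at h1 ⊢
    linarith

end Capacity

/-! ### MSR codes for r = 1 -/

section RepetitionCode

open Module

/-- All nodes store the same block, and each of the α helpers sends a different symbol of it,
repeated β times. -/
lemma exists_isLinearMSR_one (F : Type) [Field F] {N α β d : ℕ} (hN : N = α + 1) (hd : d + 1 = N)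
    (hβ : 1 ≤ β) :
    ∃ (C : Submodule F (Fin N → Block F α))
      (V : Fin N → Finset (Fin N) → Fin N → (Block F α →ₗ[F] Block F β)),
      IsLinearMSR 1 d C V := by
  classical
  have hcard : ∀ j : Fin N, Fintype.card {i // i ≠ j} = Fintype.card (Fin α) := by
    intro j
    rw [Fintype.card_subtype_compl, Fintype.card_subtype_eq, Fintype.card_fin, Fintype.card_fin, hN]
    rfl
  let e : ∀ j : Fin N, {i // i ≠ j} ≃ Fin α := fun j => Fintype.equivOfCardEq (hcard j)
  let rep : Block F α →ₗ[F] (Fin N → Block F α) := LinearMap.pi fun _ => LinearMap.id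
  have hrep : Function.Injective rep := fun x y h => congrFun h ⟨0, by omega⟩
  refine ⟨LinearMap.range rep, fun j _ i => if h : i ≠ j then
    LinearMap.pi fun _ => LinearMap.proj (e j ⟨i, h⟩) else 0, ?_, ?_, ?_⟩
  · rw [LinearMap.finrank_range_of_inj hrep]
    simp
  · rintro _ ⟨x, rfl⟩ A hA h
    obtain ⟨i, hi⟩ := Finset.card_pos.1 (by omega : 0 < A.card)
    funext i'
    exact h i hi
  · rintro j D hj hD _ ⟨x, rfl⟩ h
    funext a
    have hmem : ((e j).symm a).1 ∈ D := by
      have : D = Finset.univ.erase j := by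
        refine Finset.eq_of_subset_of_card_le (fun i hi => ?_) ?_
        · exact Finset.mem_erase.2 ⟨fun h => hj (h ▸ hi), Finset.mem_univ _⟩
        · rw [Finset.card_erase_of_mem (Finset.mem_univ _), Finset.card_univ, Fintype.card_fin]
          omega
      rw [this]
      exact Finset.mem_erase.2 ⟨((e j).symm a).2, Finset.mem_univ _⟩
    have h1 := h _ hmem
    rw [dif_pos ((e j).symm a).2] at h1
    have h2 := congrFun h1 ⟨0, hβ⟩
    simpa [rep] using h2

end RepetitionCode

/-! ### Coupled-layer MSR codes for r ≥ 2 -/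

section CoupledLayers

open Module

variable {F : Type} [Field F] {r s : ℕ}

/-- The nodes of the coupled layer code form a grid with `r` rows of `s` nodes. -/
abbrev GridWord (F : Type) (r s : ℕ) : Type := Fin r × Fin s → (Fin r → Fin s) → F

/-- The layers of a node are coupled in pairs with layers of the other nodes in its row. -/
def coupled (γ : F) (w : GridWord F r s) (p : Fin r × Fin s) (z : Fin r → Fin s) : F :=
  w p z + if p.2 = z p.1 then 0 else γ * w (p.1, z p.1) (Function.update z p.1 p.2)

/-- The parity checks: in every layer, the coupled symbols form a codeword of a generalized
Reed-Solomon code with `s` parity checks. -/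
def gridCheck (γ : F) (θ : Fin r × Fin s → F) :
    GridWord F r s →ₗ[F] (Fin s → (Fin r → Fin s) → F) where
  toFun w l z := ∑ p, coupled γ w p z * θ p ^ (l : ℕ)
  map_add' w w' := by
    funext l z
    simp only [Pi.add_apply, ← Finset.sum_add_distrib, coupled]
    refine Finset.sum_congr rfl fun p _ => ?_
    split_ifs <;> ring
  map_smul' a w := by
    funext l z
    simp only [Pi.smul_apply, smul_eq_mul, RingHom.id_apply, Finset.mul_sum, coupled]
    refine Finset.sum_congr rfl fun p _ => ?_
    split_ifs <;> ring

lemma eq_zero_of_power_sums {ι : Type*} {θ : ι → F} (hθ : Function.Injective θ) (E : Finset ι)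
    {m : ℕ} (hE : E.card ≤ m) (f : ι → F)
    (h : ∀ l : Fin m, ∑ p ∈ E, f p * θ p ^ (l : ℕ) = 0) : ∀ p ∈ E, f p = 0 := by
  have h0 : (fun i => f (E.equivFin.symm i).1) = 0 := by
    refine Matrix.eq_zero_of_forall_pow_sum_mul_pow_eq_zero
      (f := fun i => θ (E.equivFin.symm i).1) ?_ fun l => ?_
    · exact hθ.comp (Subtype.val_injective.comp E.equivFin.symm.injective)
    · rw [← h ⟨l, l.2.trans_le hE⟩, ← Finset.sum_coe_sort E]
      exact Equiv.sum_comp E.equivFin.symm fun p : E => f p * θ p ^ (l : ℕ)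
  intro p hp
  simpa using congrFun h0 (E.equivFin ⟨p, hp⟩)

/-- In one layer, at most s unknown coupled symbols face s Vandermonde checks. -/
lemma coupled_eq_zero {γ : F} {θ : Fin r × Fin s → F} (hθ : Function.Injective θ)
    {w : GridWord F r s} (hw : gridCheck γ θ w = 0) (E : Finset (Fin r × Fin s)) (hE : E.card ≤ s)
    (z : Fin r → Fin s) (h : ∀ p ∉ E, coupled γ w p z = 0) (p : Fin r × Fin s) :
    coupled γ w p z = 0 := by
  by_cases hp : p ∈ E
  · refine eq_zero_of_power_sums hθ E hE (fun p => coupled γ w p z) (fun l => ?_) p hp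
    rw [Finset.sum_subset (Finset.subset_univ E) fun p _ hpE => by rw [h p hpE, zero_mul]]
    exact congrFun (congrFun hw l) z
  · exact h p hp

/-- A codeword that is supported on `s` nodes is zero. -/
lemma grid_eq_zero_of_support {γ : F} (hγ : γ ^ 2 ≠ 1) {θ : Fin r × Fin s → F}
    (hθ : Function.Injective θ) {w : GridWord F r s} (hw : gridCheck γ θ w = 0)
    (E : Finset (Fin r × Fin s)) (hE : E.card ≤ s) (h : ∀ p ∉ E, ∀ z, w p z = 0)
    (z : Fin r → Fin s) : ∀ p, w p z = 0 := by
  classical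
  -- Layers are decoded in order of the number of rows whose distinguished node `(x, z x)` lies in
  -- `E`.
  let score : (Fin r → Fin s) → ℕ := fun z => (Finset.univ.filter fun x => (x, z x) ∈ E).card
  induction hn : score z using Nat.strong_induction_on generalizing z with
  | _ n ih =>
  have hU : ∀ z', score z' = n → ∀ p, coupled γ w p z' = 0 := by
    intro z' hz'
    refine coupled_eq_zero hθ hw E hE z' ?_
    rintro ⟨x, y⟩ hp
    rw [coupled, h _ hp, zero_add]
    split_ifs with hy
    · rfl
    by_cases hx : (x, z' x) ∈ E
    -- The partner layer replaces a distinguished node in `E` by one outside, so its score is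
    -- smaller.
    · refine mul_eq_zero_of_right _ (ih _ ?_ _ rfl _)
      rw [← hz']
      refine Finset.card_lt_card ⟨fun x' hx' => ?_, fun hsub => ?_⟩
      · rw [Finset.mem_filter] at hx' ⊢
        refine ⟨hx'.1, ?_⟩
        by_cases hxx : x' = x
        · exact hxx ▸ hx
        · simpa [hxx] using hx'.2
      · have := hsub (Finset.mem_filter.2 ⟨Finset.mem_univ x, hx⟩)
        rw [Finset.mem_filter, Function.update_self] at this
        exact hp this.2
    · rw [h _ hx, mul_zero]
  rintro ⟨x, y⟩
  by_cases hp : (x, y) ∈ E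
  swap
  · exact h _ hp z
  have h1 := hU z hn (x, y)
  rw [coupled] at h1
  split_ifs at h1 with hy
  · simpa using h1
  by_cases hx : (x, z x) ∈ E
  swap
  · simpa [h _ hx] using h1
  have hscore : score (Function.update z x y) = n := by
    rw [← hn]
    refine congrArg Finset.card (Finset.filter_congr fun x' _ => ?_)
    by_cases hxx : x' = x
    · subst hxx
      rw [Function.update_self]
      exact iff_of_true hp hx
    · simp [hxx]
  -- The two coupled symbols of a pair form a 2 × 2 system of determinant 1 - γ².
  have h2 := hU _ hscore (x, z x)
  simp only [coupled, Function.update_self, Function.update_idem, Function.update_eq_self] at h1 h2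
  rw [if_neg (fun h => hy h.symm)] at h2
  have h3 : (1 - γ ^ 2) * w (x, y) z = 0 := by linear_combination h1 - γ * h2
  exact (mul_eq_zero.1 h3).resolve_left (sub_ne_zero.2 hγ.symm)

/-- A codeword is determined at the node `p₀` by the symbols of the other nodes
in `1 / s` of the layers. -/
lemma grid_repair {γ : F} (hγ : γ ≠ 0) {θ : Fin r × Fin s → F} (hθ : Function.Injective θ)
    {w : GridWord F r s} (hw : gridCheck γ θ w = 0) (p₀ : Fin r × Fin s)
    (h : ∀ p, p ≠ p₀ → ∀ z : Fin r → Fin s, z p₀.1 = p₀.2 → w p z = 0) (z : Fin r → Fin s) :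
    w p₀ z = 0 := by
  classical
  obtain ⟨x₀, y₀⟩ := p₀
  simp only at h
  -- Outside row `x₀`, coupling stays within the layers with `z x₀ = y₀`, so only the s symbols of
  -- that row are unknown.
  have hU : ∀ z, z x₀ = y₀ → ∀ p, coupled γ w p z = 0 := by
    intro z hz
    refine coupled_eq_zero hθ hw ({x₀} ×ˢ Finset.univ) (by simp) z ?_
    rintro ⟨x, y⟩ hp
    have hx : x ≠ x₀ := by rintro rfl; exact hp (by simp)
    rw [coupled, h _ (fun e => hx (congrArg Prod.fst e)) z hz, zero_add]
    split_ifs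
    · rfl
    · refine mul_eq_zero_of_right _ (h _ (fun e => hx (congrArg Prod.fst e)) _ ?_)
      simp [hx.symm, hz]
  -- This coupled symbol joins a helper's known symbol to γ times the wanted one, unless `z` itself
  -- is a downloaded layer.
  have h1 := hU (Function.update z x₀ y₀) (by simp) (x₀, z x₀)
  simp only [coupled, Function.update_self, Function.update_idem, Function.update_eq_self] at h1
  split_ifs at h1 with hy
  · rw [add_zero, ← hy, Function.update_eq_self] at h1
    rw [← hy]
    exact h1
  · rw [h (x₀, z x₀) (fun e => hy (congrArg Prod.snd e)) _ (by simp), zero_add] at h1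
    exact (mul_eq_zero.1 h1).resolve_left hγ

/-- Padding with zeros: a word of a shortened code as a word on the grid. -/
def padGrid {N α : ℕ} (ν : Fin N → Fin r × Fin s) (e : Fin α ≃ (Fin r → Fin s)) :
    (Fin N → Block F α) →ₗ[F] GridWord F r s where
  toFun c p z := ∑ i, if ν i = p then c i (e.symm z) else 0
  map_add' c c' := by
    funext p z
    simp only [Pi.add_apply, ← Finset.sum_add_distrib]
    refine Finset.sum_congr rfl fun i _ => ?_
    split_ifs <;> simp
  map_smul' a c := by
    funext p z
    simp [Finset.mul_sum]

lemma padGrid_apply {N α : ℕ} {ν : Fin N → Fin r × Fin s} (hν : Function.Injective ν)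
    (e : Fin α ≃ (Fin r → Fin s)) (c : Fin N → Block F α) (i : Fin N) (z : Fin r → Fin s) :
    padGrid ν e c (ν i) z = c i (e.symm z) := by
  change ∑ i', (if ν i' = ν i then c i' (e.symm z) else 0) = _
  rw [Finset.sum_eq_single i]
  · simp
  · intro i' _ hi
    rw [if_neg fun h => hi (hν h)]
  · simp

lemma padGrid_eq_zero {N α : ℕ} (ν : Fin N → Fin r × Fin s) (e : Fin α ≃ (Fin r → Fin s))
    (c : Fin N → Block F α) (p : Fin r × Fin s) (z : Fin r → Fin s)
    (h : ∀ i, ν i = p → c i (e.symm z) = 0) : padGrid ν e c p z = 0 := by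
  change ∑ i, (if ν i = p then c i (e.symm z) else 0) = 0
  refine Finset.sum_eq_zero fun i _ => ?_
  split_ifs with hi
  · exact h i hi
  · rfl

lemma card_layers (x₀ : Fin r) (y₀ : Fin s) :
    Fintype.card {z : Fin r → Fin s // z x₀ = y₀} = s ^ (r - 1) := by
  classical
  have e : {z : Fin r → Fin s // z x₀ = y₀} ≃ ({x // x ≠ x₀} → Fin s) :=
    { toFun := fun z => ((Equiv.funSplitAt x₀ (Fin s)) z.1).2
      invFun := fun t => ⟨(Equiv.funSplitAt x₀ (Fin s)).symm (y₀, t), by simp⟩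
      left_inv := by
        rintro ⟨z, rfl⟩
        refine Subtype.ext ?_
        exact (Equiv.funSplitAt x₀ (Fin s)).symm_apply_apply z
      right_inv := fun t => by
        simp only [Equiv.apply_symm_apply] }
  rw [Fintype.card_congr e]
  simp [Fintype.card_subtype_compl]

lemma exists_isLinearMSR_of_two_le (hr : 2 ≤ r) (hs : 2 ≤ s) {N α β d : ℕ} (hN : N = r + s)
    (hd : d + 1 = N) (hα : α = s ^ r) (hβ : β = s ^ (r - 1)) :
    ∃ (F : Type) (_ : Field F) (_ : Fintype F) (C : Submodule F (Fin N → Block F α))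
      (V : Fin N → Finset (Fin N) → Fin N → (Block F α →ₗ[F] Block F β)),
      IsLinearMSR r d C V := by
  classical
  -- Room for rs evaluation points, and 2 and 3 are nonzero, so that γ = 2 is admissible.
  obtain ⟨q, hq, hqp⟩ := Nat.exists_infinite_primes (r * s + 5)
  have : Fact q.Prime := ⟨hqp⟩
  have hcast : ∀ m : ℕ, 0 < m → m < q → (m : ZMod q) ≠ 0 := by
    intro m hm hmq h
    rw [ZMod.natCast_eq_zero_iff] at h
    exact absurd (Nat.le_of_dvd hm h) (by omega)
  have hγ0 : (2 : ZMod q) ≠ 0 := by exact_mod_cast hcast 2 (by omega) (by omega)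
  have hγ1 : (2 : ZMod q) ^ 2 ≠ 1 := by
    intro h
    refine hcast 3 (by omega) (by omega) ?_
    push_cast
    linear_combination h
  obtain ⟨⟨θ, hθ⟩⟩ : Nonempty (Fin r × Fin s ↪ ZMod q) :=
    Function.Embedding.nonempty_of_card_le (by simp [ZMod.card]; omega)
  -- r + s ≤ rs needs r, s ≥ 2, whence the separate case r = 1. Grid nodes outside the image of `ν`
  -- are shortened to zero.
  obtain ⟨⟨ν, hν⟩⟩ : Nonempty (Fin N ↪ Fin r × Fin s) :=
    Function.Embedding.nonempty_of_card_le (by simp [hN]; nlinarith)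
  let e : Fin α ≃ (Fin r → Fin s) := Fintype.equivOfCardEq (by simp [hα])
  let lay : ∀ j : Fin N, Fin β ≃ {z : Fin r → Fin s // z (ν j).1 = (ν j).2} :=
    fun j => Fintype.equivOfCardEq (by rw [card_layers, Fintype.card_fin, hβ])
  let H := (gridCheck (2 : ZMod q) θ).comp (padGrid ν e)
  have hmds : ∀ c ∈ LinearMap.ker H, ∀ A : Finset (Fin N), A.card = r → (∀ i ∈ A, c i = 0) →
      c = 0 := by
    intro c hc A hA h
    have hz := grid_eq_zero_of_support hγ1 hθ (w := padGrid ν e c) (LinearMap.mem_ker.1 hc)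
      (Aᶜ.image ν) (Finset.card_image_le.trans (by
        rw [Finset.card_compl, Fintype.card_fin]; omega)) (by
        intro p hp z
        refine padGrid_eq_zero ν e c p z fun i hi => ?_
        have : i ∈ A := by
          by_contra hiA
          exact hp (Finset.mem_image.2 ⟨i, by simpa using hiA, hi⟩)
        rw [h i this]; rfl)
    funext i a
    have := hz (e a) (ν i)
    rwa [padGrid_apply hν, Equiv.symm_apply_apply] at this
  refine ⟨ZMod q, inferInstance, inferInstance, LinearMap.ker H,
    fun j _ _ => LinearMap.pi fun b => LinearMap.proj (e.symm (lay j b).1), ?_, hmds, ?_⟩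
  -- The MDS property gives at most rα; at most sα independent checks on (r + s)α symbols give at
  -- least rα.
  · refine le_antisymm ?_ ?_
    · obtain ⟨A, -, hA⟩ := Finset.exists_subset_card_eq (s := (Finset.univ : Finset (Fin N)))
        (n := r) (by simp; omega)
      have hinj : Function.Injective (restrictTo (LinearMap.ker H) A) := by
        rw [← LinearMap.ker_eq_bot, LinearMap.ker_eq_bot']
        intro c hc
        exact Subtype.ext (hmds c c.2 A hA fun i hi => congrFun hc ⟨i, hi⟩)
      have := LinearMap.finrank_le_finrank_of_injective hinj
      rwa [finrank_pi_block, hA] at this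
    · have h1 := LinearMap.finrank_range_add_finrank_ker H
      have h2 := Submodule.finrank_le (LinearMap.range H)
      have h3 : finrank (ZMod q) (Fin N → Block (ZMod q) α) = N * α := by
        rw [finrank_pi_fintype]; simp
      have h4 : finrank (ZMod q) (Fin s → (Fin r → Fin s) → ZMod q) = s * α := by
        rw [finrank_pi_fintype]; simp [hα]
      rw [h3] at h1
      rw [h4] at h2
      have h5 : N * α = r * α + s * α := by rw [hN, add_mul]
      omega
  · intro j D hj hD c hc h
    have hDmem : ∀ i, i ≠ j → i ∈ D := by
      have : D = Finset.univ.erase j := by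
        refine Finset.eq_of_subset_of_card_le (fun i hi => ?_) ?_
        · exact Finset.mem_erase.2 ⟨fun h => hj (h ▸ hi), Finset.mem_univ _⟩
        · rw [Finset.card_erase_of_mem (Finset.mem_univ _), Finset.card_univ, Fintype.card_fin]
          omega
      intro i hi
      rw [this]
      exact Finset.mem_erase.2 ⟨hi, Finset.mem_univ _⟩
    have hz := grid_repair hγ0 hθ (w := padGrid ν e c) (LinearMap.mem_ker.1 hc) (ν j) (by
      intro p hp z hz
      refine padGrid_eq_zero ν e c p z fun i hi => ?_
      have hij : i ≠ j := fun h => hp (by rw [← hi, h])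
      have h1 := congrFun (h i (hDmem i hij)) ((lay j).symm ⟨z, hz⟩)
      simpa using h1)
    funext a
    have := hz (e a)
    rwa [padGrid_apply hν, Equiv.symm_apply_apply] at this

end CoupledLayers

/-- Linear MSR codes with `s` parity nodes, all surviving nodes as helpers and `s ^ r` symbols
per node. -/
lemma exists_isLinearMSR {r s : ℕ} (hr : 1 ≤ r) (hs : 2 ≤ s) {N α β d : ℕ} (hN : N = r + s)
    (hd : d + 1 = N) (hα : α = s ^ r) (hβ : β = s ^ (r - 1)) :
    ∃ (F : Type) (_ : Field F) (_ : Fintype F) (C : Submodule F (Fin N → Block F α))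
      (V : Fin N → Finset (Fin N) → Fin N → (Block F α →ₗ[F] Block F β)),
      IsLinearMSR r d C V := by
  rcases hr.lt_or_eq with hr | rfl
  · exact exists_isLinearMSR_of_two_le hr hs hN hd hα hβ
  · have : Fact (Nat.Prime 2) := ⟨Nat.prime_two⟩
    exact ⟨ZMod 2, inferInstance, inferInstance,
      exists_isLinearMSR_one (ZMod 2) (by rw [hN, hα, pow_one, add_comm]) hd (by simp [hβ])⟩

/-! ### The secrecy capacity -/

theorem theorem8 (g r δ α β d dmin : ℕ)
    (hr : 1 ≤ r) (hδ : 2 < δ) (hβ : 1 ≤ β) (hd : r ≤ d) (hd' : d ≤ r + δ - 2)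
    (hα : α = (d - r + 1) * β) :
    -- the secrecy capacity, with the upper bound also for codes that are not `dmin`-optimal
    (∀ n μ h ℓ₁ ℓ₂ : ℕ, n = g * (r + δ - 1) →
      μ = (n - dmin + 1) / (r + δ - 1) → h = (n - dmin + 1) - (r + δ - 1) * μ →
      ℓ₂ * r + ℓ₁ ≤ μ * r + min h r →
      (∀ Ms ∈ secureFileSizes g r δ α β d dmin ℓ₁ ℓ₂,
        (Ms : ℤ) ≤ ((μ : ℤ) * r + min h r - ℓ₂ - ℓ₁) * α - ℓ₂ * ((r : ℤ) - 1) * β) ∧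
      (ExistsLinearMSRLRC g r δ α β d dmin →
        IsGreatest ((fun Ms : ℕ => (Ms : ℤ)) '' secureFileSizesOptimal g r δ α β d dmin ℓ₁ ℓ₂)
          (((μ : ℤ) * r + min h r - ℓ₂ - ℓ₁) * α - ℓ₂ * ((r : ℤ) - 1) * β))) ∧
    -- codes as required exist for `d = r + δ - 2`, `α = (δ - 1) ^ r` and file size `k * α`
    (d = r + δ - 2 → α = (δ - 1) ^ r → ∀ k : ℕ, r ≤ k → k ≤ g * r →
      IsDminOptimal (g * (r + δ - 1)) (k * α) r δ α dmin →
      ExistsLinearMSRLRC g r δ α β d dmin) := by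
  have hα1 : 1 ≤ α := by
    rw [hα]
    exact Nat.mul_pos (Nat.succ_pos _) hβ
  refine ⟨?_, ?_⟩
  · rintro n μ h ℓ₁ ℓ₂ rfl hμ hh hℓ
    have hle := fun Ms hMs => secureFileSizes_le (Ms := Ms) (α := α) (β := β) (d := d)
      hr hδ hμ hh hℓ hMs
    refine ⟨hle, fun hex => ⟨?_, ?_⟩⟩
    · obtain ⟨Ms, hMs, heq⟩ := mem_secureFileSizesOptimal hr hδ hα1 hd hd' hα hμ hh hℓ hex
      exact ⟨Ms, hMs, heq⟩
    · rintro _ ⟨Ms, ⟨F, hF, hF', R, enc, V, hinj, hLRC, -, hsec⟩, rfl⟩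
      exact hle Ms ⟨F, hF, hF', R, enc, V, hinj, hLRC, hsec⟩
  · intro hdeq hαeq k hrk hkg hopt
    have hβeq : β = (δ - 1) ^ (r - 1) := by
      have h1 : (δ - 1) * β = (δ - 1) * (δ - 1) ^ (r - 1) := by
        rw [← pow_succ', Nat.sub_add_cancel hr, ← hαeq, hα]
        congr 1
        omega
      exact Nat.eq_of_mul_eq_mul_left (by omega) h1
    obtain ⟨F, _, _, C₀, V₀, h₀⟩ := exists_isLinearMSR hr (by omega : 2 ≤ δ - 1)
      (N := r + δ - 1) (d := d) (by omega) (by omega) hαeq hβeq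
    exact existsLinearMSRLRC_of_isLinearMSR h₀ hr (by omega) hα1 hd (by omega) hα.symm hrk hkg hopt
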